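/- Let $a<b\le a+2\pi$ and let $I=\{e^{it}:a\le t\le b\}$ be a compact arc of the unit circle. Let $k\in\{0,1,2,\dots\}\cup\{\infty\}$. Let $C^k(I)$ be the space of functions $u:I\to\mathbb{C}$ such that $\theta\mapsto u(e^{i\theta})$, defined on $\{\theta\in\mathbb{R}: e^{i\theta}\in I\}$, is $k$ times continuously differentiable (one-sidedly at the end points of the arc; for $b=a+2\pi$, $I$ is the whole circle and there are no end points), with the topology defined by the seminorms $\sup_{\theta\in[a,b]}\left|\frac{d^l u(e^{i\theta})}{d\theta^l}\right|$, $l=0,1,2,\dots$, $l\le k$. For $z_0\in I$ and $r>0$ let $D(z_0,r)$ be the open disk with center $z_0$ and radius $r$, and let $$\Omega(z_0,r)=D(z_0,r)\cap\{|z|>1\},\qquad P(z_0,r)=D(z_0,r)\cap\{|z|<1\}.$$ Define the following subsets of $C^k(I)$. - $U_2(I,k)$: the set of $u\in C^k(I)$ such that for no $z_0\in I$ and $r>0$ there is a continuous function $\lambda:I\cup\Omega(z_0,r)\to\mathbb{C}$, holomorphic in $\Omega(z_0,r)$, with $\lambda=u$ on $D(z_0,r)\cap I$. - $U_3(I,k)$: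 the set of $u\in C^k(I)$ such that for no $z_0\in I$ and $r>0$ there is a continuous function $h:I\cup P(z_0,r)\to\mathbb{C}$, holomorphic in $P(z_0,r)$, with $h=u$ on $D(z_0,r)\cap I$. - $U_4(I,k)$: the set of $u\in C^k(I)$ such that for no $z_0\in I$ and $r>0$ there is a function $\lambda$ as in the definition of $U_2(I,k)$ or a function $h$ as in the definition of $U_3(I,k)$. - $U_5(I,k)$: the set of $u\in C^k(I)$ such that for no $z_0\in I$ and $r>0$ there is a holomorphic function $f:D(z_0,r)\to\mathbb{C}$ with $f=u$ on $D(z_0,r)\cap I$. Then each of $U_2(I,k)$, $U_3(I,k)$, $U_4(I,k)$ and $U_5(I,k)$ is a dense $G_\delta$ subset of $C^k(I)$. -/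

import Mathlib

open scoped Real

/-- A compact arc `{e^{it} : a ≤ t ≤ b}` of the unit circle, `a < b ≤ a + 2π`
(the whole circle, `b = a + 2π`, is allowed). -/
structure CompactArc where
  a : ℝ
  b : ℝ
  a_lt_b : a < b
  b_le : b ≤ a + 2 * π

namespace CompactArc

/-- The arc as a set of complex numbers. -/
def carrier (I : CompactArc) : Set ℂ :=
  {z | ∃ t ∈ Set.Icc I.a I.b, z = Complex.exp (t * Complex.I)}

/-- All real angles `θ` with `e^{iθ}` on the arc. -/
def angles (I : CompactArc) : Set ℝ :=
  {θ | Complex.exp (θ * Complex.I) ∈ I.carrier}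

/-- `θ ↦ u(e^{iθ})` for `u : I → ℂ`; the value `0` taken off `I.angles` is never used. -/
noncomputable def pullback (I : CompactArc) (u : I.carrier → ℂ) (θ : ℝ) : ℂ :=
  Function.extend Subtype.val u 0 (Complex.exp (θ * Complex.I))

theorem mem_carrier_of_mem_Icc (I : CompactArc) {t : ℝ} (ht : t ∈ Set.Icc I.a I.b) :
    Complex.exp (t * Complex.I) ∈ I.carrier := ⟨t, ht, rfl⟩

theorem Icc_subset_angles (I : CompactArc) : Set.Icc I.a I.b ⊆ I.angles :=
  fun _ ht => I.mem_carrier_of_mem_Icc ht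

theorem pullback_of_mem (I : CompactArc) (u : I.carrier → ℂ) {θ : ℝ} (h : θ ∈ I.angles) :
    I.pullback u θ = u ⟨Complex.exp (θ * Complex.I), h⟩ :=
  Subtype.val_injective.extend_apply u 0 (⟨Complex.exp (θ * Complex.I), h⟩ : I.carrier)

theorem pullback_add (I : CompactArc) (u v : I.carrier → ℂ) :
    I.pullback (u + v) = I.pullback u + I.pullback v := by
  funext θ
  by_cases h : ∃ z : I.carrier, (z : ℂ) = Complex.exp (θ * Complex.I)
  · obtain ⟨z, hz⟩ := h
    simp [pullback, ← hz]
  · simp [pullback, Function.extend_apply' _ _ _ h]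

theorem pullback_smul (I : CompactArc) (c : ℂ) (u : I.carrier → ℂ) :
    I.pullback (c • u) = c • I.pullback u := by
  funext θ
  by_cases h : ∃ z : I.carrier, (z : ℂ) = Complex.exp (θ * Complex.I)
  · obtain ⟨z, hz⟩ := h
    simp [pullback, ← hz]
  · simp [pullback, Function.extend_apply' _ _ _ h]

theorem pullback_zero (I : CompactArc) : I.pullback 0 = 0 := by
  simpa using I.pullback_smul 0 0

theorem uniqueDiffOn_angles (I : CompactArc) : UniqueDiffOn ℝ I.angles := by
  rintro θ ⟨t, ht, hθ⟩
  obtain ⟨n, hn⟩ := Complex.exp_eq_exp_iff_exists_int.1 hθ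
  have hn' : θ = t + n * (2 * π) := by
    have h1 : (θ : ℂ) * Complex.I = ((t + n * (2 * π) : ℝ) : ℂ) * Complex.I := by
      rw [hn]; push_cast; ring
    exact_mod_cast mul_right_cancel₀ Complex.I_ne_zero h1
  have hsub : Set.Icc (I.a + n * (2 * π)) (I.b + n * (2 * π)) ⊆ I.angles := by
    intro s hs
    refine ⟨s - n * (2 * π), ⟨by linarith [hs.1], by linarith [hs.2]⟩, ?_⟩
    refine Complex.exp_eq_exp_iff_exists_int.2 ⟨n, ?_⟩
    push_cast; ring
  have hmem : θ ∈ Set.Icc (I.a + n * (2 * π)) (I.b + n * (2 * π)) :=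
    ⟨by linarith [ht.1], by linarith [ht.2]⟩
  exact (uniqueDiffOn_Icc (by linarith [I.a_lt_b]) θ hmem).mono hsub

/-- The functions `u : I → ℂ` for which `θ ↦ u(e^{iθ})` is `k` times continuously differentiable
(one-sidedly at the end points of a proper arc; infinitely often if `k = ⊤`), as a vector space. -/
def ckSubmodule (I : CompactArc) (k : ℕ∞) : Submodule ℂ (I.carrier → ℂ) where
  carrier := {u | ContDiffOn ℝ k (I.pullback u) I.angles}
  add_mem' := by
    intro u v hu hv
    rw [Set.mem_ofPred_eq, pullback_add]
    exact ContDiffOn.add hu hv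
  zero_mem' := by
    rw [Set.mem_ofPred_eq, pullback_zero]
    exact contDiffOn_const
  smul_mem' := by
    intro c u hu
    rw [Set.mem_ofPred_eq, pullback_smul]
    exact ContDiffOn.const_smul c hu

/-- The space `C^k(I)`. It is a type of its own, so that it does not inherit the topology of
pointwise convergence. -/
def Ck (I : CompactArc) (k : ℕ∞) : Type := I.ckSubmodule k

variable {I : CompactArc} {k : ℕ∞}

noncomputable instance : AddCommGroup (Ck I k) :=
  inferInstanceAs (AddCommGroup (I.ckSubmodule k))

noncomputable instance : Module ℂ (Ck I k) :=
  inferInstanceAs (Module ℂ (I.ckSubmodule k))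

instance : CoeFun (Ck I k) (fun _ => I.carrier → ℂ) := ⟨fun u => u.1⟩

/-- The `l`-th derivative `d^l u(e^{iθ}) / dθ^l`. -/
noncomputable def Ck.angularDeriv (u : Ck I k) (l : ℕ) (θ : ℝ) : ℂ :=
  iteratedDerivWithin l (I.pullback u) I.angles θ

theorem Ck.continuousOn_angularDeriv (u : Ck I k) {l : ℕ} (hl : (l : ℕ∞) ≤ k) :
    ContinuousOn (u.angularDeriv l) I.angles :=
  ContDiffOn.continuousOn_iteratedDerivWithin u.2 (by exact_mod_cast hl) I.uniqueDiffOn_angles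

theorem Ck.bddAbove_angularDeriv (u : Ck I k) {l : ℕ} (hl : (l : ℕ∞) ≤ k) :
    BddAbove (Set.range fun θ : Set.Icc I.a I.b => ‖u.angularDeriv l θ‖) := by
  have h := (isCompact_Icc (a := I.a) (b := I.b)).bddAbove_image
    ((u.continuousOn_angularDeriv hl).mono I.Icc_subset_angles).norm
  rwa [Set.image_eq_range] at h

theorem Ck.angularDeriv_add (u v : Ck I k) {l : ℕ} (hl : (l : ℕ∞) ≤ k) {θ : ℝ}
    (hθ : θ ∈ I.angles) :
    (u + v).angularDeriv l θ = u.angularDeriv l θ + v.angularDeriv l θ := by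
  have h : I.pullback (u + v : Ck I k) = I.pullback u + I.pullback v := I.pullback_add u.1 v.1
  have hl' : ((l : ℕ) : WithTop ℕ∞) ≤ (k : WithTop ℕ∞) := by exact_mod_cast hl
  have hu : ContDiffOn ℝ k (I.pullback u) I.angles := u.2
  have hv : ContDiffOn ℝ k (I.pullback v) I.angles := v.2
  unfold Ck.angularDeriv
  rw [h]
  exact iteratedDerivWithin_add hθ I.uniqueDiffOn_angles
    ((hu θ hθ).of_le hl') ((hv θ hθ).of_le hl')

theorem Ck.angularDeriv_smul (c : ℂ) (u : Ck I k) {l : ℕ} (hl : (l : ℕ∞) ≤ k) {θ : ℝ}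
    (hθ : θ ∈ I.angles) :
    (c • u).angularDeriv l θ = c * u.angularDeriv l θ := by
  have h : I.pullback (c • u : Ck I k) = c • I.pullback u := I.pullback_smul c u.1
  have hl' : ((l : ℕ) : WithTop ℕ∞) ≤ (k : WithTop ℕ∞) := by exact_mod_cast hl
  have hu : ContDiffOn ℝ k (I.pullback u) I.angles := u.2
  unfold Ck.angularDeriv
  rw [h, iteratedDerivWithin_const_smul hθ I.uniqueDiffOn_angles c ((hu θ hθ).of_le hl'),
    smul_eq_mul]

/-- The seminorm `u ↦ sup_{θ ∈ [a,b]} |d^l u(e^{iθ}) / dθ^l|` of `C^k(I)`, for `l ≤ k`. -/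
noncomputable def ckSeminorm (I : CompactArc) (k : ℕ∞) (l : {l : ℕ // (l : ℕ∞) ≤ k}) :
    Seminorm ℂ (Ck I k) :=
  Seminorm.of (fun u => ⨆ θ : Set.Icc I.a I.b, ‖u.angularDeriv l θ‖)
    (by
      intro u v
      have : Nonempty (Set.Icc I.a I.b) := ⟨⟨I.a, le_refl _, I.a_lt_b.le⟩⟩
      refine ciSup_le fun θ => ?_
      rw [Ck.angularDeriv_add u v l.2 (I.Icc_subset_angles θ.2)]
      exact (norm_add_le _ _).trans (add_le_add
        (le_ciSup (u.bddAbove_angularDeriv l.2) θ) (le_ciSup (v.bddAbove_angularDeriv l.2) θ)))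
    (by
      intro c u
      rw [Real.mul_iSup_of_nonneg (norm_nonneg c)]
      refine iSup_congr fun θ => ?_
      rw [Ck.angularDeriv_smul c u l.2 (I.Icc_subset_angles θ.2), norm_mul])

instance : Nonempty {l : ℕ // (l : ℕ∞) ≤ k} := ⟨⟨0, by simp⟩⟩

/-- The locally convex topology of `C^k(I)` defined by the seminorms
`sup_{θ ∈ [a,b]} |d^l u(e^{iθ}) / dθ^l|`, `l = 0, 1, 2, …`, `l ≤ k`. -/
noncomputable instance : TopologicalSpace (Ck I k) :=
  (SeminormFamily.moduleFilterBasis (𝕜 := ℂ) (ckSeminorm I k)).topology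

theorem withSeminorms_ckSeminorm (I : CompactArc) (k : ℕ∞) :
    WithSeminorms (ckSeminorm I k) := ⟨rfl⟩

/-- `D(z₀, r) ∩ {|z| > 1}`. -/
def outerDomain (z₀ : ℂ) (r : ℝ) : Set ℂ := Metric.ball z₀ r ∩ {z | 1 < ‖z‖}

/-- `D(z₀, r) ∩ {|z| < 1}`. -/
def innerDomain (z₀ : ℂ) (r : ℝ) : Set ℂ := Metric.ball z₀ r ∩ {z | ‖z‖ < 1}

/-- For `Ω` one of the two domains above: there is a continuous function on `I ∪ Ω`, holomorphic
in `Ω`, which coincides with `u` on `D(z₀, r) ∩ I`. -/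
def ExtendsTo (I : CompactArc) (u : I.carrier → ℂ) (z₀ : ℂ) (r : ℝ) (Ω : Set ℂ) : Prop :=
  ∃ f : ℂ → ℂ, ContinuousOn f (I.carrier ∪ Ω) ∧ DifferentiableOn ℂ f Ω ∧
    ∀ z : I.carrier, (z : ℂ) ∈ Metric.ball z₀ r → f z = u z

/-- No exterior one-sided extension at `z₀`. -/
def U₂At (I : CompactArc) (z₀ : ℂ) (k : ℕ∞) : Set (Ck I k) :=
  {u | ¬ ∃ r : ℝ, 0 < r ∧ I.ExtendsTo u z₀ r (outerDomain z₀ r)}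

/-- No interior one-sided extension at `z₀`. -/
def U₃At (I : CompactArc) (z₀ : ℂ) (k : ℕ∞) : Set (Ck I k) :=
  {u | ¬ ∃ r : ℝ, 0 < r ∧ I.ExtendsTo u z₀ r (innerDomain z₀ r)}

/-- Neither an exterior nor an interior one-sided extension at `z₀`. -/
def U₄At (I : CompactArc) (z₀ : ℂ) (k : ℕ∞) : Set (Ck I k) :=
  {u | (¬ ∃ r : ℝ, 0 < r ∧ I.ExtendsTo u z₀ r (outerDomain z₀ r)) ∧
    ¬ ∃ r : ℝ, 0 < r ∧ I.ExtendsTo u z₀ r (innerDomain z₀ r)}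

/-- No disk `D(z₀, r)` with a holomorphic function on it that coincides with `u` on
`D(z₀, r) ∩ I`. -/
def U₅At (I : CompactArc) (z₀ : ℂ) (k : ℕ∞) : Set (Ck I k) :=
  {u | ¬ ∃ r : ℝ, 0 < r ∧ ∃ f : ℂ → ℂ, DifferentiableOn ℂ f (Metric.ball z₀ r) ∧
    ∀ z : I.carrier, (z : ℂ) ∈ Metric.ball z₀ r → f z = u z}

/-- The class `U₂(I, k)`. -/
def U₂ (I : CompactArc) (k : ℕ∞) : Set (Ck I k) := ⋂ z₀ ∈ I.carrier, U₂At I z₀ k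

/-- The class `U₃(I, k)`. -/
def U₃ (I : CompactArc) (k : ℕ∞) : Set (Ck I k) := ⋂ z₀ ∈ I.carrier, U₃At I z₀ k

/-- The class `U₄(I, k)`. -/
def U₄ (I : CompactArc) (k : ℕ∞) : Set (Ck I k) := ⋂ z₀ ∈ I.carrier, U₄At I z₀ k

/-- The class `U₅(I, k)`. -/
def U₅ (I : CompactArc) (k : ℕ∞) : Set (Ck I k) := ⋂ z₀ ∈ I.carrier, U₅At I z₀ k

end CompactArc

/-! Each class is described by `nonExt I k A`, where `A` is a side of the circle or the whole plane;
`U₄` is the intersection of the two one-sided classes.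

Gδ: every disk centred on `I` contains a disk from a countable family whose trace on the circle lies
in `I`, so end points of the arc need no separate treatment. On such a disk an extension is bounded
by some natural number. The set of functions with an extension bounded by `M` need not be shown
closed: its closure consists of functions that still extend to a smaller disk
(`closure_bddExt_subset`), which is enough because the radius is arbitrary. Hence `nonExt` is a
countable intersection of complements of closures. The closure statement rests on a two constants
theorem (`norm_le_of_norm_le_on_arc`): bounded extensions whose boundary values converge uniformly
on `I` converge uniformly near the centre.

Density: suppose `u₀` extends across no inner disk to either side. For given `u` and a given disk,
at most one real `t` makes `u + t u₀` extendable, since the extendable functions form a subspace. So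
all but countably many `t` are good, and `t → 0` along good values. No Baire category argument is
needed.

The function `u₀` is the sum of `(z ^ 2 ^ n + z⁻¹ ^ 2 ^ n) / n!`. It is smooth on the circle. If it
extended outwards near a point, a tail of the series would extend too and inherit the tail's
invariance under a small rotation; shifting the contour in a Fourier integral over that short period
would force its coefficients to decay like `exp (-2 ^ n δ)`, whereas they are `1 / n!`. The symmetry
`z ↦ z⁻¹` settles the inner side. -/

/-! ### Two constants theorem on one side of the circle -/

/-- A barrier for the two constants theorem, on the circular part of the boundary. -/
theorem barrier_re_nonpos {s ρ : ℝ} (hs : s = 1 ∨ s = -1) (hρ : 0 < ρ) (hρ' : ρ ≤ 1 / 4) {w : ℂ}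
    (hw : ‖w‖ = ρ) (hside : 0 ≤ s * (‖1 + w‖ - 1)) :
    ((ρ ^ 2 / 2 : ℝ) + w ^ 2 - (2 * s * ρ : ℝ) * w : ℂ).re ≤ 0 := by
  have h1 : w.re ^ 2 + w.im ^ 2 = ρ ^ 2 := by
    rw [← hw, Complex.sq_norm, Complex.normSq_apply]; ring
  have h2 : ‖1 + w‖ ^ 2 = 1 + 2 * w.re + ρ ^ 2 := by
    rw [Complex.sq_norm, Complex.normSq_apply, ← h1]; simp; ring
  have hx : |w.re| ≤ ρ := hw ▸ Complex.abs_re_le_norm w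
  obtain ⟨hx1, hx2⟩ := abs_le.1 hx
  have hn : 0 ≤ ‖1 + w‖ := norm_nonneg _
  have h3 : 0 ≤ s * (2 * w.re + ρ ^ 2) := by
    have : s * (2 * w.re + ρ ^ 2) = s * (‖1 + w‖ - 1) * (‖1 + w‖ + 1) := by
      linear_combination (-s) * h2
    rw [this]; positivity
  have h4 : ((ρ ^ 2 / 2 : ℝ) + w ^ 2 - (2 * s * ρ : ℝ) * w : ℂ).re
      = 2 * w.re ^ 2 - ρ ^ 2 / 2 - 2 * s * ρ * w.re := by
    simp only [Complex.sub_re, Complex.add_re, Complex.ofReal_re, Complex.ofReal_im, pow_two,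
      Complex.mul_re]
    linear_combination (-1 : ℝ) * h1
  rw [h4]
  -- With `y = s * w.re` the expression is `2y² - 2ρy - ρ²/2`, convex in `y`, and the side condition
  -- gives `-ρ²/2 ≤ y ≤ ρ`. It is nonpositive at both ends because `ρ ≤ 1 / 4`.
  rcases hs with rfl | rfl
  · nlinarith [mul_nonneg (by linarith : 0 ≤ 2 * w.re + ρ ^ 2) (by linarith : 0 ≤ ρ - w.re),
      mul_pos hρ hρ, mul_pos (mul_pos hρ hρ) hρ]
  · nlinarith [mul_nonneg (by linarith : 0 ≤ -(2 * w.re + ρ ^ 2)) (by linarith : 0 ≤ ρ + w.re),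
      mul_pos hρ hρ, mul_pos (mul_pos hρ hρ) hρ]

theorem abs_barrier_sub_le {s ρ : ℝ} (hs : s = 1 ∨ s = -1) (hρ : 0 < ρ) (w : ℂ) :
    |((ρ ^ 2 / 2 : ℝ) + w ^ 2 - (2 * s * ρ : ℝ) * w : ℂ).re - ρ ^ 2 / 2|
      ≤ ‖w‖ ^ 2 + 2 * ρ * ‖w‖ := by
  have h : ((ρ ^ 2 / 2 : ℝ) + w ^ 2 - (2 * s * ρ : ℝ) * w : ℂ).re - ρ ^ 2 / 2
      = (w ^ 2 - (2 * s * ρ : ℝ) * w).re := by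
    simp only [Complex.sub_re, Complex.add_re, Complex.ofReal_re]; ring
  rw [h]
  refine (Complex.abs_re_le_norm _).trans ((norm_sub_le _ _).trans ?_)
  rw [norm_pow, norm_mul, Complex.norm_real, Real.norm_eq_abs, abs_mul, abs_mul, abs_of_pos hρ]
  rcases hs with rfl | rfl <;> simp

/-- A two constants theorem for one side of the unit circle near a point `z₀` of the circle. -/
theorem norm_le_of_norm_le_on_arc {s ρ M ε K : ℝ} (hs : s = 1 ∨ s = -1) (hρ : 0 < ρ)
    (hρ' : ρ ≤ 1 / 4) {z₀ : ℂ} (hz₀ : ‖z₀‖ = 1) {f : ℂ → ℂ}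
    (hd : DifferentiableOn ℂ f (Metric.ball z₀ ρ ∩ {z | 0 < s * (‖z‖ - 1)}))
    (hc : ContinuousOn f (Metric.closedBall z₀ ρ ∩ {z | 0 ≤ s * (‖z‖ - 1)}))
    (hM : ∀ z ∈ Metric.closedBall z₀ ρ, 0 ≤ s * (‖z‖ - 1) → ‖f z‖ ≤ M)
    (hε : ∀ z ∈ Metric.closedBall z₀ ρ, ‖z‖ = 1 → ‖f z‖ ≤ ε) (hK : 0 ≤ K)
    (hKε : ε * Real.exp (4 * ρ ^ 2 * K) ≤ M) {z : ℂ} (hz : z ∈ Metric.closedBall z₀ (ρ / 16))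
    (hzs : 0 ≤ s * (‖z‖ - 1)) : ‖f z‖ ≤ M * Real.exp (-(K * (ρ ^ 2 / 4))) := by
  have hz₀0 : z₀ ≠ 0 := by rintro rfl; simp at hz₀
  have hs0 : s ≠ 0 := by rcases hs with rfl | rfl <;> norm_num
  have hε0 : 0 ≤ ε := (norm_nonneg _).trans (hε z₀ (Metric.mem_closedBall_self hρ.le) hz₀)
  set U : Set ℂ := Metric.ball z₀ ρ ∩ {z | 0 < s * (‖z‖ - 1)} with hU
  set h : ℂ → ℂ := fun z => (ρ ^ 2 / 2 : ℝ) + (z / z₀ - 1) ^ 2 - (2 * s * ρ : ℝ) * (z / z₀ - 1)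
    with hh
  have hw : ∀ x : ℂ, ‖x / z₀ - 1‖ = dist x z₀ := fun x => by
    rw [dist_eq_norm, div_sub_one hz₀0, norm_div, hz₀, div_one]
  have hcont : Continuous fun z : ℂ => s * (‖z‖ - 1) := by fun_prop
  have hcl : closure U ⊆ Metric.closedBall z₀ ρ ∩ {z | 0 ≤ s * (‖z‖ - 1)} :=
    closure_minimal (Set.inter_subset_inter Metric.ball_subset_closedBall
      fun x (hx : 0 < s * (‖x‖ - 1)) => hx.le)
      (Metric.isClosed_closedBall.inter (isClosed_le continuous_const hcont))
  have hUo : IsOpen U := Metric.isOpen_ball.inter (isOpen_lt continuous_const hcont)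
  have hhd : Differentiable ℂ h := by
    rw [hh]; fun_prop
  rcases hzs.lt_or_eq with hlt | heq
  -- Maximum principle for `f * exp (K h)`: on the circular part of the frontier `Re h ≤ 0` and `M`
  -- bounds `f`; on the arc `Re h ≤ 4ρ²`, and the smallness of `ε` compensates.
  · have hzU : z ∈ U := ⟨Metric.closedBall_subset_ball (by linarith) hz, hlt⟩
    have key : ‖f z * Complex.exp (K * h z)‖ ≤ M := by
      refine Complex.norm_le_of_forall_mem_frontier_norm_le
        (f := fun z => f z * Complex.exp (K * h z))
        (Metric.isBounded_ball.subset Set.inter_subset_left) ⟨?_, ?_⟩ ?_ (subset_closure hzU)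
      · exact hd.mul (by fun_prop)
      · refine (hc.mono hcl).mul (Continuous.continuousOn ?_)
        have := hhd.continuous
        fun_prop
      · intro x hx
        have hx1 := hcl (frontier_subset_closure hx)
        have hxU : x ∉ U := by
          rw [hUo.frontier_eq] at hx; exact hx.2
        have hxK : (K * h x : ℂ).re = K * (h x).re := Complex.re_ofReal_mul _ _
        rw [norm_mul, Complex.norm_exp, hxK]
        rcases (Metric.mem_closedBall.1 hx1.1).lt_or_eq with hlt' | heq'
        · have hx2 : ‖x‖ = 1 := by
            have h0 : ¬ 0 < s * (‖x‖ - 1) := fun h' => hxU ⟨hlt', h'⟩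
            have h00 : s * (‖x‖ - 1) = 0 := le_antisymm (not_lt.1 h0) hx1.2
            rcases mul_eq_zero.1 h00 with h' | h'
            · exact absurd h' hs0
            · linarith
          refine le_trans ?_ hKε
          refine mul_le_mul (hε x hx1.1 hx2) (Real.exp_le_exp.2 ?_) (Real.exp_pos _).le hε0
          have hb := (abs_le.1 (abs_barrier_sub_le hs hρ (x / z₀ - 1))).2
          rw [hw] at hb
          have hd0 : 0 ≤ dist x z₀ := dist_nonneg
          have : (h x).re ≤ 4 * ρ ^ 2 := by
            simp only [hh]
            nlinarith
          nlinarith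
        · have hb := barrier_re_nonpos hs hρ hρ' (w := x / z₀ - 1) (by rw [hw, heq']) (by
            rw [add_sub_cancel, norm_div, hz₀, div_one]; exact hx1.2)
          have h1 : Real.exp (K * (h x).re) ≤ 1 :=
            Real.exp_le_one_iff.2 (mul_nonpos_of_nonneg_of_nonpos hK hb)
          have h2 := hM x hx1.1 hx1.2
          nlinarith [norm_nonneg (f x), Real.exp_pos (K * (h x).re)]
    have hzK : (K * h z : ℂ).re = K * (h z).re := Complex.re_ofReal_mul _ _
    rw [norm_mul, Complex.norm_exp, hzK] at key
    have hb := (abs_le.1 (abs_barrier_sub_le hs hρ (z / z₀ - 1))).1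
    rw [hw] at hb
    have hd0 : 0 ≤ dist z z₀ := dist_nonneg
    have hd1 : dist z z₀ ≤ ρ / 16 := hz
    -- At the centre `Re h = ρ²/2`; within distance `ρ / 16` it changes by at most `ρ²/256 + ρ²/8`.
    have hre : ρ ^ 2 / 4 ≤ (h z).re := by
      simp only [hh]
      nlinarith
    rw [Real.exp_neg, ← div_eq_mul_inv, le_div_iff₀ (Real.exp_pos _)]
    refine le_trans ?_ key
    gcongr
  · have hz1 : ‖z‖ = 1 := by
      rcases mul_eq_zero.1 heq.symm with h' | h'
      · exact absurd h' hs0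
      · linarith
    have h1 := hε z (Metric.closedBall_subset_closedBall (by linarith) hz) hz1
    rw [Real.exp_neg, ← div_eq_mul_inv, le_div_iff₀ (Real.exp_pos _)]
    exact (mul_le_mul h1 (Real.exp_le_exp.2 (by nlinarith [mul_nonneg hK (sq_nonneg ρ)]))
      (Real.exp_pos _).le hε0).trans hKε

/-- A function on one side of the unit circle which vanishes on an arc vanishes near the arc. -/
theorem eq_zero_of_eq_zero_on_arc {s ρ : ℝ} (hs : s = 1 ∨ s = -1) (hρ : 0 < ρ)
    (hρ' : ρ ≤ 1 / 4) {z₀ : ℂ} (hz₀ : ‖z₀‖ = 1) {f : ℂ → ℂ}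
    (hd : DifferentiableOn ℂ f (Metric.ball z₀ ρ ∩ {z | 0 < s * (‖z‖ - 1)}))
    (hc : ContinuousOn f (Metric.closedBall z₀ ρ ∩ {z | 0 ≤ s * (‖z‖ - 1)}))
    (h0 : ∀ z ∈ Metric.closedBall z₀ ρ, ‖z‖ = 1 → f z = 0)
    {z : ℂ} (hz : z ∈ Metric.closedBall z₀ (ρ / 16))
    (hzs : 0 ≤ s * (‖z‖ - 1)) : f z = 0 := by
  have hcpt : IsCompact (Metric.closedBall z₀ ρ ∩ {z | 0 ≤ s * (‖z‖ - 1)}) :=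
    (isCompact_closedBall z₀ ρ).inter_right (isClosed_le continuous_const (by fun_prop))
  obtain ⟨M, hM⟩ := hcpt.exists_bound_of_continuousOn hc
  have hM0 : 0 ≤ M := (norm_nonneg _).trans (hM z₀ ⟨Metric.mem_closedBall_self hρ.le, by simp [hz₀]⟩)
  -- With `ε = 0` the constraint on `K` disappears, so `K` may tend to infinity.
  have key : ∀ K : ℝ, 0 ≤ K → ‖f z‖ ≤ M * Real.exp (-(K * (ρ ^ 2 / 4))) := fun K hK =>
    norm_le_of_norm_le_on_arc hs hρ hρ' hz₀ hd hc (fun z h1 h2 => hM z ⟨h1, h2⟩)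
      (ε := 0) (fun z h1 h2 => by rw [h0 z h1 h2, norm_zero]) hK (by simpa using hM0) hz hzs
  have hlim : Filter.Tendsto (fun K : ℝ => M * Real.exp (-(K * (ρ ^ 2 / 4)))) Filter.atTop
      (nhds (M * 0)) :=
    (Real.tendsto_exp_neg_atTop_nhds_zero.comp
      (Filter.tendsto_id.atTop_mul_const (by positivity : 0 < ρ ^ 2 / 4))).const_mul M
  rw [mul_zero] at hlim
  have := ge_of_tendsto hlim ((Filter.eventually_ge_atTop 0).mono key)
  exact norm_le_zero_iff.1 this

/-! ### Uniform approximation and continuity in `C^k(I)` -/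

namespace CompactArc

variable {I : CompactArc} {k : ℕ∞}

theorem Ck.norm_apply_le (u : Ck I k) (w : I.carrier) :
    ‖u w‖ ≤ ckSeminorm I k ⟨0, by simp⟩ u := by
  obtain ⟨_, t, ht, rfl⟩ := w
  have h := le_ciSup (u.bddAbove_angularDeriv (l := 0) (by simp)) ⟨t, ht⟩
  simp only [Ck.angularDeriv, iteratedDerivWithin_zero] at h
  rw [I.pullback_of_mem _ (I.Icc_subset_angles ht)] at h
  refine h.trans_eq ?_
  simp only [ckSeminorm, Ck.angularDeriv, iteratedDerivWithin_zero]
  rfl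

/-- An element of the closure of a set is uniformly approximated by elements of the set. -/
theorem exists_mem_norm_sub_lt {S : Set (Ck I k)} {u : Ck I k} (hu : u ∈ closure S) {ε : ℝ}
    (hε : 0 < ε) : ∃ v ∈ S, ∀ w : I.carrier, ‖v w - u w‖ < ε := by
  have hp := (withSeminorms_ckSeminorm I k).topologicalAddGroup
  have hcont := (withSeminorms_ckSeminorm I k).continuous_seminorm ⟨0, by simp⟩
  have hc : Continuous fun v : Ck I k => ckSeminorm I k ⟨0, by simp⟩ (v - u) :=
    hcont.comp (continuous_id.sub continuous_const)
  obtain ⟨v, hv, hvS⟩ := mem_closure_iff.1 hu _ (isOpen_lt hc continuous_const)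
    (show ckSeminorm I k ⟨0, by simp⟩ (u - u) < ε by simpa using hε)
  exact ⟨v, hvS, fun w => ((v - u).norm_apply_le w).trans_lt hv⟩

theorem continuous_coe (u : Ck I k) : Continuous (u : I.carrier → ℂ) := by
  have hcont : Continuous fun t : Set.Icc I.a I.b =>
      (⟨_, I.mem_carrier_of_mem_Icc t.2⟩ : I.carrier) :=
    Continuous.subtype_mk (by fun_prop) _
  have hsurj : Function.Surjective fun t : Set.Icc I.a I.b =>
      (⟨_, I.mem_carrier_of_mem_Icc t.2⟩ : I.carrier) := by
    rintro ⟨_, t, ht, rfl⟩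
    exact ⟨⟨t, ht⟩, rfl⟩
  -- The parametrization of the arc by `[a, b]` is a continuous surjection from a compact space to a
  -- Hausdorff one, hence a quotient map, also when the arc is the whole circle.
  rw [(hcont.isClosedMap.isQuotientMap hcont hsurj).continuous_iff]
  have hu : ContinuousOn (I.pullback u) (Set.Icc I.a I.b) :=
    (ContDiffOn.continuousOn u.2).mono I.Icc_subset_angles
  rw [continuousOn_iff_continuous_domRestrict] at hu
  exact hu.congr fun t => I.pullback_of_mem _ (I.Icc_subset_angles t.2)

/-! ### Spaces of extendable functions and their closures -/

/-- An open set which is a union of some of: the two sides of the unit circle, the circle. -/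
structure IsSideUnion (A : Set ℂ) : Prop where
  isOpen : IsOpen A
  isClosed_union : IsClosed (A ∪ Metric.sphere 0 1)
  side_subset : ∀ s : ℝ, s = 1 ∨ s = -1 → ∀ z ∈ A, 0 < s * (‖z‖ - 1) →
    {w : ℂ | 0 < s * (‖w‖ - 1)} ⊆ A

theorem isSideUnion_side {s : ℝ} (hs : s = 1 ∨ s = -1) :
    IsSideUnion {z : ℂ | 0 < s * (‖z‖ - 1)} where
  isOpen := isOpen_lt continuous_const (by fun_prop)
  isClosed_union := by
    have : {z : ℂ | 0 < s * (‖z‖ - 1)} ∪ Metric.sphere 0 1 = {z : ℂ | 0 ≤ s * (‖z‖ - 1)} := by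
      ext z
      have hs0 : s ≠ 0 := by rcases hs with rfl | rfl <;> norm_num
      simp [le_iff_lt_or_eq, hs0, sub_eq_zero, @eq_comm ℝ 0]
    rw [this]
    exact isClosed_le continuous_const (by fun_prop)
  side_subset := by
    intro t ht z hz hzt
    rcases hs with rfl | rfl <;> rcases ht with rfl | rfl <;>
      first | exact subset_rfl | (exfalso; simp only [Set.mem_ofPred_eq] at hz; linarith)

theorem isSideUnion_univ : IsSideUnion Set.univ where
  isOpen := isOpen_univ
  isClosed_union := by simp
  side_subset := by simp

/-- `z` is a point of the circle whose `ρ`-neighbourhood in the circle is contained in `I`. -/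
structure IsInner (I : CompactArc) (z : ℂ) (ρ : ℝ) : Prop where
  pos : 0 < ρ
  le : ρ ≤ 1 / 4
  norm_eq : ‖z‖ = 1
  mem : ∀ w ∈ Metric.closedBall z ρ, ‖w‖ = 1 → w ∈ I.carrier

/-- The functions which extend continuously to `I ∪ (D(z, ρ) ∩ A)`, holomorphically in
`D(z, ρ) ∩ A`. -/
def locExt (I : CompactArc) (k : ℕ∞) (A : Set ℂ) (z : ℂ) (ρ : ℝ) : Submodule ℂ (Ck I k) where
  carrier := {u | ∃ f : ℂ → ℂ, ContinuousOn f (I.carrier ∪ Metric.ball z ρ ∩ A) ∧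
    DifferentiableOn ℂ f (Metric.ball z ρ ∩ A) ∧ ∀ w : I.carrier, f w = u w}
  add_mem' := by
    rintro u v ⟨f, hf, hf', hfu⟩ ⟨g, hg, hg', hgv⟩
    exact ⟨f + g, hf.add hg, hf'.add hg', fun w => congrArg₂ (· + ·) (hfu w) (hgv w)⟩
  zero_mem' := ⟨0, continuousOn_const, differentiableOn_const 0, fun _ => rfl⟩
  smul_mem' := by
    rintro c u ⟨f, hf, hf', hfu⟩
    exact ⟨c • f, hf.const_smul c, hf'.const_smul c, fun w => congrArg (c * ·) (hfu w)⟩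

/-- The functions with an extension as in `locExt` bounded by `M`. -/
def bddExt (I : CompactArc) (k : ℕ∞) (A : Set ℂ) (z : ℂ) (ρ M : ℝ) : Set (Ck I k) :=
  {u | ∃ f : ℂ → ℂ, ContinuousOn f (I.carrier ∪ Metric.ball z ρ ∩ A) ∧
    DifferentiableOn ℂ f (Metric.ball z ρ ∩ A) ∧ (∀ w : I.carrier, f w = u w) ∧
    ∀ w ∈ I.carrier ∪ Metric.ball z ρ ∩ A, ‖f w‖ ≤ M}

/-- A point of the small disk lying in `A` but not in `I` is off the circle, so it lies on one side,
and that whole side is in `A`. The two constants theorem is applied there with radius `ρ / 2`, whose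
closed disk stays inside the open disk of radius `ρ`; this produces `ρ / 32`, `ρ ^ 2` and `ρ ^ 2 /
16`. -/
theorem IsSideUnion.norm_le {A : Set ℂ} (hA : IsSideUnion A) {z₀ : ℂ} {ρ M ε K : ℝ}
    (hz₀ : I.IsInner z₀ ρ) {f : ℂ → ℂ}
    (hc : ContinuousOn f (I.carrier ∪ Metric.ball z₀ ρ ∩ A))
    (hd : DifferentiableOn ℂ f (Metric.ball z₀ ρ ∩ A))
    (hM : ∀ w ∈ I.carrier ∪ Metric.ball z₀ ρ ∩ A, ‖f w‖ ≤ M)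
    (hε : ∀ w ∈ I.carrier, ‖f w‖ ≤ ε) (hK : 0 ≤ K)
    (hKε : ε * Real.exp (ρ ^ 2 * K) ≤ M) {z : ℂ}
    (hz : z ∈ I.carrier ∪ Metric.ball z₀ (ρ / 32) ∩ A) :
    ‖f z‖ ≤ M * Real.exp (-(K * (ρ ^ 2 / 16))) := by
  have hρ := hz₀.pos
  have hε0 : 0 ≤ ε := (norm_nonneg _).trans
    (hε z₀ (hz₀.mem _ (Metric.mem_closedBall_self hρ.le) hz₀.norm_eq))
  by_cases hzI : z ∈ I.carrier
  · rw [Real.exp_neg, ← div_eq_mul_inv, le_div_iff₀ (Real.exp_pos _)]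
    exact (mul_le_mul (hε z hzI) (Real.exp_le_exp.2 (by nlinarith [mul_nonneg hK (sq_nonneg ρ)]))
      (Real.exp_pos _).le hε0).trans hKε
  · obtain ⟨hzb, hzA⟩ := hz.resolve_left hzI
    have hz1 : ‖z‖ ≠ 1 := fun h => hzI (hz₀.mem z
      (Metric.ball_subset_closedBall (Metric.ball_subset_ball (by linarith) hzb)) h)
    obtain ⟨s, hs, hzs⟩ : ∃ s : ℝ, (s = 1 ∨ s = -1) ∧ 0 < s * (‖z‖ - 1) := by
      rcases hz1.lt_or_gt with h | h
      · exact ⟨-1, Or.inr rfl, by linarith⟩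
      · exact ⟨1, Or.inl rfl, by linarith⟩
    have hsA := hA.side_subset s hs z hzA hzs
    have hsub : Metric.closedBall z₀ (ρ / 2) ∩ {z | 0 ≤ s * (‖z‖ - 1)} ⊆
        I.carrier ∪ Metric.ball z₀ ρ ∩ A := by
      rintro x ⟨hx1, hx2⟩
      rcases lt_or_eq_of_le (show 0 ≤ s * (‖x‖ - 1) from hx2) with h | h
      · exact Or.inr ⟨Metric.closedBall_subset_ball (by linarith) hx1, hsA h⟩
      · refine Or.inl (hz₀.mem x (Metric.closedBall_subset_closedBall (by linarith) hx1) ?_)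
        rcases hs with rfl | rfl <;> linarith
    have := norm_le_of_norm_le_on_arc hs (half_pos hρ) (by linarith [hz₀.le]) hz₀.norm_eq
      (hd.mono (Set.inter_subset_inter (Metric.ball_subset_ball (by linarith)) hsA))
      (hc.mono hsub) (fun x h1 h2 => hM x (hsub ⟨h1, h2⟩))
      (fun x h1 h2 => hε x (hz₀.mem x (Metric.closedBall_subset_closedBall (by linarith) h1) h2))
      hK (by convert hKε using 3; ring) (z := z)
      (by convert Metric.ball_subset_closedBall hzb using 2; ring) hzs.le
    convert this using 4
    ring

/-- The extensions of a uniformly convergent sequence of boundary values are uniformly Cauchy on the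
smaller domain by the two constants bound for their differences, and the uniform limit is the
required extension. Only the seminorm of order `0` is used. -/
theorem closure_bddExt_subset {A : Set ℂ} (hA : IsSideUnion A) {z₀ : ℂ} {ρ M : ℝ}
    (hz₀ : I.IsInner z₀ ρ) :
    closure (bddExt I k A z₀ ρ M) ⊆ locExt I k A z₀ (ρ / 32) := by
  intro u hu
  have hρ := hz₀.pos
  choose v hv hvu using fun n : ℕ => exists_mem_norm_sub_lt hu (Nat.one_div_pos_of_nat (n := n))
  choose f hfc hfd hfv hfM using hv
  set S := I.carrier ∪ Metric.ball z₀ (ρ / 32) ∩ A with hS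
  have hsub : Metric.ball z₀ (ρ / 32) ∩ A ⊆ Metric.ball z₀ ρ ∩ A :=
    Set.inter_subset_inter_left _ (Metric.ball_subset_ball (by linarith))
  have hSsub : S ⊆ I.carrier ∪ Metric.ball z₀ ρ ∩ A := Set.union_subset_union_right _ hsub
  have hM0 : 0 ≤ M := (norm_nonneg _).trans (hfM 0 z₀ (Or.inl
    (hz₀.mem _ (Metric.mem_closedBall_self hρ.le) hz₀.norm_eq)))
  have hlim : Filter.Tendsto (fun K : ℝ => (M + M + 1) * Real.exp (-(K * (ρ ^ 2 / 16))))
      Filter.atTop (nhds ((M + M + 1) * 0)) :=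
    (Real.tendsto_exp_neg_atTop_nhds_zero.comp
      (Filter.tendsto_id.atTop_mul_const (by positivity : 0 < ρ ^ 2 / 16))).const_mul _
  rw [mul_zero] at hlim
  have hcauchy : UniformCauchySeqOn f Filter.atTop S := by
    rw [Metric.uniformCauchySeqOn_iff]
    intro δ hδ
    -- `K` is chosen first, then `ε = exp (-ρ²K)`, so that `ε * exp (ρ²K) = 1`. The summand `1` in
    -- `M + M + 1` makes this at most the bound used for the differences.
    obtain ⟨K, hK, hKδ⟩ := ((Filter.eventually_ge_atTop 0).and (hlim.eventually_lt_const hδ)).exists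
    set ε := Real.exp (-(ρ ^ 2 * K)) with hε
    have hεpos : 0 < ε / 2 := half_pos (Real.exp_pos _)
    obtain ⟨N, hN⟩ := exists_nat_one_div_lt hεpos
    refine ⟨N, fun m hm n hn x hx => ?_⟩
    rw [dist_eq_norm]
    refine lt_of_le_of_lt ?_ hKδ
    refine hA.norm_le hz₀ (f := fun z => f m z - f n z) (ε := ε) ((hfc m).sub (hfc n))
      ((hfd m).sub (hfd n)) ?_ ?_ hK ?_ hx
    · intro w hw
      exact ((norm_sub_le _ _).trans (add_le_add (hfM m w hw) (hfM n w hw))).trans (by linarith)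
    · intro w hw
      have h1 := hvu m ⟨w, hw⟩
      have h2 := hvu n ⟨w, hw⟩
      rw [← hfv m ⟨w, hw⟩] at h1
      rw [← hfv n ⟨w, hw⟩, norm_sub_rev] at h2
      have h3 := Nat.one_div_le_one_div (α := ℝ) hm
      have h4 := Nat.one_div_le_one_div (α := ℝ) hn
      calc ‖f m w - f n w‖ ≤ _ := norm_sub_le_norm_sub_add_norm_sub _ (u ⟨w, hw⟩) _
        _ ≤ ε := by linarith
    · rw [hε, ← Real.exp_add]
      simp; linarith
  have hex : ∀ x, ∃ y, x ∈ S → Filter.Tendsto (fun n => f n x) Filter.atTop (nhds y) := by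
    intro x
    by_cases hx : x ∈ S
    · obtain ⟨y, hy⟩ := cauchySeq_tendsto_of_complete (hcauchy.cauchySeq hx)
      exact ⟨y, fun _ => hy⟩
    · exact ⟨0, fun h => absurd h hx⟩
  choose F hF using hex
  have hunif := hcauchy.tendstoUniformlyOn_of_tendsto hF
  refine ⟨F, hunif.continuousOn (Filter.Frequently.of_forall fun n => (hfc n).mono hSsub),
    (hunif.mono Set.subset_union_right).tendstoLocallyUniformlyOn.differentiableOn
      (Filter.Eventually.of_forall fun n => (hfd n).mono hsub)
      (Metric.isOpen_ball.inter hA.isOpen), fun w => ?_⟩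
  refine tendsto_nhds_unique (hF w (Or.inl w.2)) ?_
  rw [tendsto_iff_norm_sub_tendsto_zero]
  refine squeeze_zero (fun _ => norm_nonneg _) (fun n => ?_) tendsto_one_div_add_atTop_nhds_zero_nat
  rw [hfv]
  exact (hvu n w).le

/-- An extension to `D(z₀, r) ∩ A` can be modified off a smaller disk so as to coincide with `u`
on `I`, and it is bounded there. -/
theorem exists_mem_bddExt {A : Set ℂ} (hA : IsSideUnion A) {u : Ck I k} {z₀ z₁ : ℂ} {r ρ : ℝ}
    (hz₁ : I.IsInner z₁ ρ) (hsub : Metric.closedBall z₁ ρ ⊆ Metric.ball z₀ r)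
    (h : I.ExtendsTo u z₀ r (Metric.ball z₀ r ∩ A)) : ∃ M : ℕ, u ∈ bddExt I k A z₁ ρ M := by
  classical
  obtain ⟨f, hfc, hfd, hfu⟩ := h
  have hcpt : IsCompact (Metric.closedBall z₁ ρ ∩ (A ∪ Metric.sphere 0 1)) :=
    (isCompact_closedBall _ _).inter_right hA.isClosed_union
  have hsub' : Metric.closedBall z₁ ρ ∩ (A ∪ Metric.sphere 0 1) ⊆
      I.carrier ∪ Metric.ball z₀ r ∩ A := by
    rintro x ⟨hx, hx' | hx'⟩
    · exact Or.inr ⟨hsub hx, hx'⟩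
    · exact Or.inl (hz₁.mem x hx (by simpa using hx'))
  obtain ⟨M, hM⟩ := hcpt.exists_bound_of_continuousOn (hfc.mono hsub')
  obtain ⟨N, hN⟩ := exists_nat_ge (max M (ckSeminorm I k ⟨0, by simp⟩ u))
  -- `F` is `u` on `I` and `f` elsewhere; it agrees with `f` on the whole disk `D(z₀, r)`.
  set F : ℂ → ℂ := Function.extend Subtype.val u f with hF
  have hFI : ∀ w : I.carrier, F w = u w := fun w => Subtype.val_injective.extend_apply _ _ _
  have hFf : ∀ w ∈ Metric.ball z₀ r, F w = f w := by
    intro w hw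
    by_cases hwI : w ∈ I.carrier
    · exact (hFI ⟨w, hwI⟩).trans (hfu ⟨w, hwI⟩ hw).symm
    · exact Function.extend_apply' _ _ _ fun ⟨x, hx⟩ => hwI (hx ▸ x.2)
  have hballs : Metric.ball z₁ ρ ∩ A ⊆ Metric.ball z₀ r ∩ A :=
    Set.inter_subset_inter_left _ (Metric.ball_subset_closedBall.trans hsub)
  refine ⟨N, F, ?_, ?_, hFI, ?_⟩
  · intro x hx
    by_cases hxb : x ∈ Metric.ball z₀ r
    · have hx' : x ∈ I.carrier ∪ Metric.ball z₀ r ∩ A := Set.union_subset_union_right _ hballs hx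
      refine ((hfc x hx').mono (Set.union_subset_union_right _ hballs)).congr_of_eventuallyEq ?_
        (hFf x hxb)
      filter_upwards [mem_nhdsWithin_of_mem_nhds (Metric.isOpen_ball.mem_nhds hxb)] with y hy
        using hFf y hy
    · have hxI : x ∈ I.carrier := hx.resolve_right fun h => hxb (hballs h).1
      have hFc : ContinuousOn F I.carrier := by
        rw [continuousOn_iff_continuous_domRestrict]
        exact (continuous_coe u).congr fun w => (hFI w).symm
      -- Near a point outside `D(z₀, r)` the domain of `F` reduces to `I`, because `closedBall z₁ ρ`
      -- stays away.
      refine (hFc x hxI).mono_of_mem_nhdsWithin ?_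
      have hxn : (Metric.closedBall z₁ ρ)ᶜ ∈ nhds x :=
        Metric.isClosed_closedBall.isOpen_compl.mem_nhds fun h => hxb (hsub h)
      filter_upwards [mem_nhdsWithin_of_mem_nhds hxn, self_mem_nhdsWithin] with y hy hy'
      exact hy'.resolve_right fun h => hy (Metric.ball_subset_closedBall h.1)
  · exact (hfd.mono hballs).congr fun x hx => hFf x (hballs hx).1
  · rintro w (hw | hw)
    · rw [hFI ⟨w, hw⟩]
      exact (u.norm_apply_le _).trans ((le_max_right _ _).trans hN)
    · rw [hFf w (hballs hw).1]
      exact (hM w ⟨Metric.ball_subset_closedBall hw.1, Or.inl hw.2⟩).trans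
        ((le_max_left _ _).trans hN)

/-! ### A countable family of inner disks -/

theorem exists_forall_dist_le_mem_carrier {θ : ℝ} (hθ : θ ∈ Set.Ioo I.a I.b) :
    ∃ δ > 0, ∀ w ∈ Metric.closedBall (Complex.exp (θ * Complex.I)) δ, ‖w‖ = 1 →
      w ∈ I.carrier := by
  set z := Complex.exp (θ * Complex.I) with hz
  have hz0 : z ≠ 0 := Complex.exp_ne_zero _
  -- A continuous local choice of angle that equals `θ` at `z`; dividing by `z` keeps `arg` away
  -- from its cut.
  have hcont : ContinuousAt (fun w : ℂ => θ + Complex.arg (w / z)) z := by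
    refine continuousAt_const.add (ContinuousAt.comp (g := Complex.arg) ?_
      (continuousAt_id.div_const z))
    simp only [div_self hz0]
    exact Complex.continuousAt_arg Complex.one_mem_slitPlane
  have hmem : ∀ᶠ w in nhds z, θ + Complex.arg (w / z) ∈ Set.Ioo I.a I.b :=
    hcont.eventually_mem (isOpen_Ioo.mem_nhds (by simpa [div_self hz0] using hθ))
  obtain ⟨δ, hδ, h⟩ := Metric.nhds_basis_closedBall.mem_iff.1 hmem
  refine ⟨δ, hδ, fun w hw hw1 => ⟨_, Set.Ioo_subset_Icc_self (h hw), ?_⟩⟩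
  have h1 := Complex.norm_mul_exp_arg_mul_I (w / z)
  rw [norm_div, hw1, hz, Complex.norm_exp_ofReal_mul_I, div_one, Complex.ofReal_one, one_mul,
    ← hz] at h1
  rw [Complex.ofReal_add, add_mul, Complex.exp_add, h1, ← hz, mul_div_cancel₀ _ hz0]

/-- The disks `D(e^{iq}, 1/(n+4))` whose intersection with the circle is in `I` form a countable
family which refines all disks centered on `I`. -/
theorem exists_isInner {z₀ : ℂ} (hz₀ : z₀ ∈ I.carrier) {r : ℝ} (hr : 0 < r) :
    ∃ (q : ℚ) (n : ℕ), I.IsInner (Complex.exp ((q : ℝ) * Complex.I)) (1 / ((n : ℝ) + 4)) ∧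
      Metric.closedBall (Complex.exp ((q : ℝ) * Complex.I)) (1 / ((n : ℝ) + 4)) ⊆
        Metric.ball z₀ r := by
  obtain ⟨t, ht, rfl⟩ := hz₀
  have hcont : Continuous fun θ : ℝ => Complex.exp (θ * Complex.I) := by fun_prop
  have hopen := Metric.isOpen_ball (x := Complex.exp (t * Complex.I)) (ε := r) |>.preimage hcont
  have htcl : t ∈ closure (Set.Ioo I.a I.b) := by
    rwa [closure_Ioo I.a_lt_b.ne]
  obtain ⟨θ, hθ1, hθ2⟩ := mem_closure_iff.1 htcl _ hopen (Metric.mem_ball_self hr)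
  obtain ⟨_, ⟨hq1, hq2⟩, q, rfl⟩ := Rat.denseRange_cast (𝕜 := ℝ).inter_open_nonempty _
    (hopen.inter isOpen_Ioo) ⟨θ, hθ1, hθ2⟩
  obtain ⟨δ, hδ, h⟩ := exists_forall_dist_le_mem_carrier hq2
  obtain ⟨η, hη, h'⟩ := Metric.nhds_basis_closedBall.mem_iff.1 (Metric.isOpen_ball.mem_nhds hq1)
  obtain ⟨n, hn⟩ := exists_nat_one_div_lt (lt_min hδ hη)
  have hn' : 1 / ((n : ℝ) + 4) ≤ min δ η :=
    (one_div_le_one_div_of_le (by positivity) (by linarith)).trans hn.le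
  refine ⟨q, n, ⟨by positivity, ?_, Complex.norm_exp_ofReal_mul_I _, fun w hw => h w ?_⟩, ?_⟩
  · exact one_div_le_one_div_of_le (by norm_num) (by linarith [n.cast_nonneg (α := ℝ)])
  · exact Metric.closedBall_subset_closedBall (hn'.trans (min_le_left _ _)) hw
  · exact (Metric.closedBall_subset_closedBall (hn'.trans (min_le_right _ _))).trans h'

theorem IsInner.mem_carrier {z : ℂ} {ρ : ℝ} (h : I.IsInner z ρ) : z ∈ I.carrier :=
  h.mem z (Metric.mem_closedBall_self h.pos.le) h.norm_eq

theorem extendsTo_of_mem_locExt {A : Set ℂ} {u : Ck I k} {z : ℂ} {ρ : ℝ}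
    (h : u ∈ locExt I k A z ρ) : I.ExtendsTo u z ρ (Metric.ball z ρ ∩ A) := by
  obtain ⟨f, h1, h2, h3⟩ := h
  exact ⟨f, h1, h2, fun w _ => h3 w⟩

/-! ### The Gδ property and density of `nonExt` -/

/-- The functions without an extension to `D(z₀, r) ∩ A` for any `z₀ ∈ I` and `r > 0`. -/
def nonExt (I : CompactArc) (k : ℕ∞) (A : Set ℂ) : Set (Ck I k) :=
  {u | ∀ z₀ ∈ I.carrier, ¬ ∃ r : ℝ, 0 < r ∧ I.ExtendsTo u z₀ r (Metric.ball z₀ r ∩ A)}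

theorem isGδ_nonExt {A : Set ℂ} (hA : IsSideUnion A) : IsGδ (nonExt I k A) := by
  have : nonExt I k A = ⋂ (i : ℚ × ℕ × ℕ),
      {u | I.IsInner (Complex.exp ((i.1 : ℝ) * Complex.I)) (1 / ((i.2.1 : ℝ) + 4)) → u ∈
        (closure (bddExt I k A (Complex.exp ((i.1 : ℝ) * Complex.I))
          (1 / ((i.2.1 : ℝ) + 4)) i.2.2))ᶜ} := by
    ext u
    rw [Set.mem_iInter]
    constructor
    · rintro hu ⟨q, n, m⟩ hin hcl
      refine hu _ hin.mem_carrier ⟨_, ?_,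
        extendsTo_of_mem_locExt (closure_bddExt_subset hA hin hcl)⟩
      have := hin.pos
      positivity
    · rintro h z₀ hz₀ ⟨r, hr, hext⟩
      obtain ⟨q, n, hin, hsub⟩ := exists_isInner hz₀ hr
      obtain ⟨m, hm⟩ := exists_mem_bddExt hA hin hsub hext
      exact h ⟨q, n, m⟩ hin (subset_closure hm)
  rw [this]
  -- For a disk that is not inner the condition is vacuous and the set is the whole space.
  refine IsGδ.iInter_of_isOpen fun i => ?_
  by_cases h : I.IsInner (Complex.exp ((i.1 : ℝ) * Complex.I)) (1 / ((i.2.1 : ℝ) + 4))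
  · simp only [h, forall_const]
    exact isClosed_closure.isOpen_compl
  · simp only [h, false_imp_iff]
    exact isOpen_const

/-- Each bad `t` is witnessed by one of countably many inner disks. Two different `t` with the same
disk would put a nonzero multiple of `u₀`, hence `u₀`, into the subspace `locExt`. -/
theorem countable_setOf_notMem_nonExt {A : Set ℂ} (hA : IsSideUnion A) {u₀ : Ck I k}
    (hu₀ : ∀ z ρ, I.IsInner z ρ → u₀ ∉ locExt I k A z ρ) (u : Ck I k) :
    {t : ℝ | u + (t : ℂ) • u₀ ∉ nonExt I k A}.Countable := by
  have hsub : {t : ℝ | u + (t : ℂ) • u₀ ∉ nonExt I k A} ⊆ ⋃ i : ℚ × ℕ,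
      {t : ℝ | I.IsInner (Complex.exp ((i.1 : ℝ) * Complex.I)) (1 / ((i.2 : ℝ) + 4)) ∧
        u + (t : ℂ) • u₀ ∈ locExt I k A (Complex.exp ((i.1 : ℝ) * Complex.I))
          (1 / ((i.2 : ℝ) + 4))} := by
    intro t ht
    obtain ⟨z₀, hz₀, r, hr, hext⟩ : ∃ z₀ ∈ I.carrier, ∃ r : ℝ, 0 < r ∧
        I.ExtendsTo (u + (t : ℂ) • u₀ : Ck I k) z₀ r (Metric.ball z₀ r ∩ A) := by
      by_contra hcon
      exact ht fun z hz h => hcon ⟨z, hz, h⟩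
    obtain ⟨q, n, hin, hsub⟩ := exists_isInner hz₀ hr
    obtain ⟨m, f, h1, h2, h3, -⟩ := exists_mem_bddExt hA hin hsub hext
    exact Set.mem_iUnion.2 ⟨(q, n), hin, f, h1, h2, h3⟩
  refine (Set.countable_iUnion fun i => Set.Subsingleton.countable ?_).mono hsub
  rintro t ⟨hin, ht⟩ t' ⟨-, ht'⟩
  by_contra hne
  refine hu₀ _ _ hin ?_
  have h := Submodule.sub_mem _ ht ht'
  rw [add_sub_add_left_eq_sub, ← sub_smul] at h
  exact (Submodule.smul_mem_iff _
    (sub_ne_zero.2 (by exact_mod_cast hne : (t : ℂ) ≠ (t' : ℂ)))).1 h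

theorem dense_nonExt_inter {A B : Set ℂ} (hA : IsSideUnion A) (hB : IsSideUnion B) {u₀ : Ck I k}
    (hu₀A : ∀ z ρ, I.IsInner z ρ → u₀ ∉ locExt I k A z ρ)
    (hu₀B : ∀ z ρ, I.IsInner z ρ → u₀ ∉ locExt I k B z ρ) :
    Dense (nonExt I k A ∩ nonExt I k B) := by
  intro u
  have := (withSeminorms_ckSeminorm I k).topologicalAddGroup
  have := (withSeminorms_ckSeminorm I k).continuousSMul
  have hc : Continuous fun t : ℝ => u + (t : ℂ) • u₀ :=
    continuous_const.add (Complex.continuous_ofReal.smul continuous_const)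
  have hd := ((countable_setOf_notMem_nonExt hA hu₀A u).union
    (countable_setOf_notMem_nonExt hB hu₀B u)).dense_compl ℝ
  have := map_mem_closure (t := nonExt I k A ∩ nonExt I k B) hc (hd 0) fun t ht => by
    simpa [not_or] using ht
  simpa using this

theorem nonExt_mono {A B : Set ℂ} (hAB : A ⊆ B) : nonExt I k A ⊆ nonExt I k B := by
  rintro u hu z hz ⟨r, hr, f, h1, h2, h3⟩
  have := Set.inter_subset_inter_right (Metric.ball z r) hAB
  exact hu z hz ⟨r, hr, f, h1.mono (Set.union_subset_union_right _ this), h2.mono this, h3⟩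

/-! ### The four classes in terms of `nonExt` -/

theorem outerDomain_eq (z : ℂ) (r : ℝ) :
    outerDomain z r = Metric.ball z r ∩ {z | 0 < (1 : ℝ) * (‖z‖ - 1)} := by
  simp [outerDomain]

theorem innerDomain_eq (z : ℂ) (r : ℝ) :
    innerDomain z r = Metric.ball z r ∩ {z | 0 < (-1 : ℝ) * (‖z‖ - 1)} := by
  simp [innerDomain]

theorem U₂_eq : U₂ I k = nonExt I k {z | 0 < (1 : ℝ) * (‖z‖ - 1)} := by
  ext u; simp only [U₂, U₂At, outerDomain_eq, nonExt, Set.mem_iInter, Set.mem_ofPred_eq]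

theorem U₃_eq : U₃ I k = nonExt I k {z | 0 < (-1 : ℝ) * (‖z‖ - 1)} := by
  ext u; simp only [U₃, U₃At, innerDomain_eq, nonExt, Set.mem_iInter, Set.mem_ofPred_eq]

theorem U₄_eq : U₄ I k = U₂ I k ∩ U₃ I k := by
  ext u
  simp only [U₄, U₄At, U₂, U₂At, U₃, U₃At, Set.mem_inter_iff, Set.mem_iInter, Set.mem_ofPred_eq]
  exact forall₂_and

theorem U₅_eq : U₅ I k = nonExt I k Set.univ := by
  ext u
  simp only [U₅, U₅At, nonExt, Set.mem_iInter, Set.mem_ofPred_eq, Set.inter_univ]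
  constructor
  · rintro h z hz ⟨r, hr, f, -, hf⟩
    exact h z hz ⟨r, hr, f, hf⟩
  · rintro h z hz ⟨r, hr, f, hf, hfu⟩
    classical
    have hF : ∀ w ∈ Metric.ball z r, Function.extend Subtype.val u f w = f w := by
      intro w hw
      by_cases hwI : w ∈ I.carrier
      · exact (Subtype.val_injective.extend_apply u f ⟨w, hwI⟩).trans (hfu ⟨w, hwI⟩ hw).symm
      · exact Function.extend_apply' _ _ _ fun ⟨x, hx⟩ => hwI (hx ▸ x.2)
    have hFI : ContinuousOn (Function.extend Subtype.val u f) I.carrier := by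
      rw [continuousOn_iff_continuous_domRestrict]
      exact (continuous_coe u).congr fun w => (Subtype.val_injective.extend_apply u f w).symm
    have hd : DifferentiableOn ℂ (Function.extend Subtype.val u f) (Metric.ball z r) :=
      hf.congr hF
    -- Overwriting `f` by `u` on `I` may break continuity at points of `I` on the boundary of the
    -- disk; halving the radius separates them from the disk.
    refine h z hz ⟨r / 2, half_pos hr, Function.extend Subtype.val u f, ?_,
      hd.mono (Metric.ball_subset_ball (by linarith)),
      fun w _ => Subtype.val_injective.extend_apply _ _ _⟩
    intro x hx
    by_cases hxb : x ∈ Metric.ball z r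
    · exact (hd.continuousOn.continuousAt (Metric.isOpen_ball.mem_nhds hxb)).continuousWithinAt
    · have hxI : x ∈ I.carrier :=
        hx.resolve_right fun h => hxb (Metric.ball_subset_ball (by linarith) h)
      refine (hFI x hxI).mono_of_mem_nhdsWithin ?_
      have hxn : (Metric.closedBall z (r / 2))ᶜ ∈ nhds x :=
        Metric.isClosed_closedBall.isOpen_compl.mem_nhds fun h =>
          hxb (Metric.closedBall_subset_ball (by linarith) h)
      filter_upwards [mem_nhdsWithin_of_mem_nhds hxn, self_mem_nhdsWithin] with y hy hy'
      exact hy'.resolve_right fun h => hy (Metric.ball_subset_closedBall h)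

end CompactArc

/-! ### The gap series and its rotation-invariant tails -/

/-- A power series with Hadamard gaps, smooth up to the unit circle. -/
noncomputable def gapSeries (z : ℂ) : ℂ := ∑' n : ℕ, z ^ 2 ^ n / (n.factorial : ℂ)

theorem norm_gapSeries_term {z : ℂ} (hz : ‖z‖ = 1) (n : ℕ) :
    ‖z ^ 2 ^ n / (n.factorial : ℂ)‖ = 1 / (n.factorial : ℝ) := by
  simp [hz]

theorem summable_gapSeries {z : ℂ} (hz : ‖z‖ = 1) :
    Summable fun n : ℕ => z ^ 2 ^ n / (n.factorial : ℂ) := by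
  refine Summable.of_norm ?_
  simp_rw [norm_gapSeries_term hz]
  simpa using Real.summable_pow_div_factorial 1

theorem iteratedDeriv_const_mul_cexp (a c : ℂ) (n : ℕ) :
    iteratedDeriv n (fun θ : ℝ => a * Complex.exp (c * θ)) =
      fun θ : ℝ => a * c ^ n * Complex.exp (c * θ) := by
  induction n with
  | zero => simp
  | succ n ih =>
    rw [iteratedDeriv_succ, ih]
    funext θ
    have h : HasDerivAt (fun θ : ℝ => c * (θ : ℂ)) (c * 1) θ :=
      (Complex.ofRealCLM.hasDerivAt (x := θ)).const_mul c
    rw [(h.cexp.const_mul (a * c ^ n)).deriv]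
    ring

theorem contDiff_gapSeries (k : ℕ∞) :
    ContDiff ℝ k fun θ : ℝ => gapSeries (Complex.exp (θ * Complex.I)) := by
  have h : (fun θ : ℝ => gapSeries (Complex.exp (θ * Complex.I))) = fun θ : ℝ => ∑' n : ℕ,
      1 / (n.factorial : ℂ) * Complex.exp (2 ^ n * Complex.I * θ) := by
    funext θ
    refine tsum_congr fun n => ?_
    have h1 : (2 ^ n * Complex.I * θ : ℂ) = ((2 ^ n : ℕ) : ℂ) * (θ * Complex.I) := by
      push_cast; ring
    rw [h1, Complex.exp_nat_mul, one_div_mul_eq_div]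
  rw [h]
  -- The `j`-th derivative of the `n`-th term is bounded by `2 ^ (n j) / n!`, summable by the
  -- exponential series.
  refine contDiff_tsum (v := fun j n => ((2 : ℝ) ^ j) ^ n / n.factorial) (fun n => ?_)
    (fun j _ => Real.summable_pow_div_factorial ((2 : ℝ) ^ j)) (fun j n θ _ => ?_)
  · have := Complex.ofRealCLM.contDiff (n := k)
    exact contDiff_const.mul ((contDiff_const.mul this).cexp)
  · rw [norm_iteratedFDeriv_eq_norm_iteratedDeriv, iteratedDeriv_const_mul_cexp]
    have : (2 ^ n * Complex.I * θ : ℂ) = ((2 ^ n * θ : ℝ) : ℂ) * Complex.I := by push_cast; ring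
    simp only [norm_mul, this, Complex.norm_exp_ofReal_mul_I, norm_div, norm_pow, Complex.norm_I]
    simp only [norm_one, Complex.norm_natCast, Complex.norm_ofNat, mul_one]
    rw [← pow_mul, ← pow_mul, mul_comm n j]
    exact le_of_eq (by ring)

/-- The real part of `gapSeries`, up to a factor, on the unit circle. -/
noncomputable def gapFunction (z : ℂ) : ℂ := gapSeries z + gapSeries z⁻¹

theorem gapFunction_inv (z : ℂ) : gapFunction z⁻¹ = gapFunction z := by
  rw [gapFunction, gapFunction, inv_inv, add_comm]

theorem contDiff_gapFunction (k : ℕ∞) :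
    ContDiff ℝ k fun θ : ℝ => gapFunction (Complex.exp (θ * Complex.I)) := by
  refine (contDiff_gapSeries k).add ?_
  convert (contDiff_gapSeries k).comp contDiff_neg using 2 with θ
  simp [← Complex.exp_neg]

/-- The partial sums of `gapFunction`. -/
noncomputable def gapPartial (N : ℕ) (z : ℂ) : ℂ :=
  ∑ n ∈ Finset.range N, (z ^ 2 ^ n / (n.factorial : ℂ) + z⁻¹ ^ 2 ^ n / (n.factorial : ℂ))

theorem gapFunction_sub_gapPartial {z : ℂ} (hz : ‖z‖ = 1) (N : ℕ) :
    HasSum (fun j : ℕ => z ^ 2 ^ (j + N) / ((j + N).factorial : ℂ) +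
      z⁻¹ ^ 2 ^ (j + N) / ((j + N).factorial : ℂ)) (gapFunction z - gapPartial N z) := by
  have hs := summable_gapSeries hz
  have hs' := summable_gapSeries (z := z⁻¹) (by rw [norm_inv, hz, inv_one])
  have h := (hs.add hs').hasSum
  rw [hs.tsum_add hs'] at h
  exact (hasSum_nat_add_iff' N).2 h

theorem differentiableOn_gapPartial (N : ℕ) : DifferentiableOn ℂ (gapPartial N) {0}ᶜ := by
  intro z hz
  have hz : z ≠ 0 := hz
  refine DifferentiableAt.differentiableWithinAt ?_
  unfold gapPartial
  have h1 : ∀ n, DifferentiableAt ℂ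
      (fun z : ℂ => z ^ 2 ^ n / (n.factorial : ℂ) + z⁻¹ ^ 2 ^ n / (n.factorial : ℂ)) z := by
    intro n
    have : DifferentiableAt ℂ (fun z : ℂ => z⁻¹) z := differentiableAt_inv hz
    fun_prop
  exact DifferentiableAt.fun_sum fun n _ => h1 n

/-- The tails of `gapFunction` are invariant under the rotations of order `2 ^ N`. -/
theorem gapFunction_sub_gapPartial_mul {z ζ : ℂ} (hz : ‖z‖ = 1) {N : ℕ} (hζ : ζ ^ 2 ^ N = 1) :
    gapFunction (ζ * z) - gapPartial N (ζ * z) = gapFunction z - gapPartial N z := by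
  have hζ1 : ‖ζ‖ = 1 := by
    have := congrArg norm hζ
    rw [norm_pow, norm_one] at this
    exact (pow_eq_one_iff_of_nonneg (norm_nonneg _) (by positivity)).1 this
  have hζ' : ∀ j, ζ ^ 2 ^ (j + N) = 1 := fun j => by
    rw [pow_add, mul_comm, pow_mul, hζ, one_pow]
  have h := gapFunction_sub_gapPartial (z := ζ * z) (by rw [norm_mul, hz, hζ1, one_mul]) N
  simp only [mul_inv, mul_pow, inv_pow, hζ', inv_one, one_mul] at h
  refine h.unique ?_
  simpa only [inv_pow] using gapFunction_sub_gapPartial hz N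

/-! ### Fourier coefficients of the tails -/

theorem integral_cexp_int_mul {c T : ℝ} {l : ℤ} (hl : l ≠ 0)
    (hT : Complex.exp (l * T * Complex.I) = 1) :
    ∫ θ in c..(c + T), Complex.exp (l * Complex.I * θ) = 0 := by
  rw [integral_exp_mul_complex (mul_ne_zero (by exact_mod_cast hl) Complex.I_ne_zero)]
  have : (l * Complex.I * (c + T : ℝ) : ℂ) = l * Complex.I * c + l * T * Complex.I := by
    push_cast; ring
  rw [this, Complex.exp_add, hT, mul_one, sub_self, zero_div]

theorem cexp_two_pow_mul_period {N j : ℕ} :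
    Complex.exp ((2 : ℂ) ^ (j + N) * ((2 * π / 2 ^ N : ℝ) : ℂ) * Complex.I) = 1 := by
  have : ((2 : ℂ) ^ (j + N) * ((2 * π / 2 ^ N : ℝ) : ℂ) * Complex.I) =
      ((2 ^ j : ℕ) : ℂ) * (2 * π * Complex.I) := by
    push_cast
    rw [pow_add]
    field_simp
  rw [this, Complex.exp_nat_mul, Complex.exp_two_pi_mul_I, one_pow]

/-- The Fourier coefficients of a tail of `gapFunction` over a period of the tail. -/
theorem integral_gapFunction_sub_gapPartial (c : ℝ) (N m : ℕ) :
    ∫ θ in c..(c + 2 * π / 2 ^ N), (gapFunction (Complex.exp (θ * Complex.I)) -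
      gapPartial N (Complex.exp (θ * Complex.I))) *
        Complex.exp (-(2 ^ (m + N) * Complex.I * θ)) =
      (2 * π / 2 ^ N : ℝ) / ((m + N).factorial : ℂ) := by
  set T : ℝ := 2 * π / 2 ^ N with hT
  set F : ℕ → ℝ → ℂ := fun j θ => (Complex.exp (θ * Complex.I) ^ 2 ^ (j + N) /
    ((j + N).factorial : ℂ) + (Complex.exp (θ * Complex.I))⁻¹ ^ 2 ^ (j + N) /
      ((j + N).factorial : ℂ)) * Complex.exp (-(2 ^ (m + N) * Complex.I * θ)) with hF
  have hF' : ∀ j θ, F j θ = 1 / ((j + N).factorial : ℂ) *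
      (Complex.exp (((2 ^ (j + N) - 2 ^ (m + N) : ℤ) : ℂ) * Complex.I * θ) +
        Complex.exp (((-2 ^ (j + N) - 2 ^ (m + N) : ℤ) : ℂ) * Complex.I * θ)) := by
    intro j θ
    simp only [hF]
    rw [← Complex.exp_neg, ← Complex.exp_nat_mul, ← Complex.exp_nat_mul, ← add_div,
      div_mul_eq_mul_div, add_mul, ← Complex.exp_add, ← Complex.exp_add, one_div_mul_eq_div]
    push_cast
    ring_nf
  have hper : ∀ j : ℕ, Complex.exp ((2 : ℂ) ^ (j + N) * T * Complex.I) = 1 := fun j =>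
    cexp_two_pow_mul_period
  -- Orthogonality over a period `2π / 2 ^ N`: the frequencies `±2 ^ (j + N) - 2 ^ (m + N)` are
  -- multiples of `2 ^ N`, and only the plus sign with `j = m` gives zero.
  have hint : ∀ j, ∫ θ in c..(c + T), F j θ =
      if j = m then (T : ℂ) / ((m + N).factorial : ℂ) else 0 := by
    intro j
    simp_rw [hF']
    have hi : ∀ l : ℤ, IntervalIntegrable (fun θ : ℝ => Complex.exp (l * Complex.I * θ))
        MeasureTheory.volume c (c + T) := fun l => by
      refine Continuous.intervalIntegrable ?_ _ _
      fun_prop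
    rw [intervalIntegral.integral_const_mul, intervalIntegral.integral_add (hi _) (hi _)]
    have h2 : ∫ θ in c..(c + T),
        Complex.exp (((-2 ^ (j + N) - 2 ^ (m + N) : ℤ) : ℂ) * Complex.I * θ) = 0 := by
      refine integral_cexp_int_mul ?_ ?_
      · have h1 : (0 : ℤ) < 2 ^ (j + N) := by positivity
        have h2 : (0 : ℤ) < 2 ^ (m + N) := by positivity
        linarith
      · have : (((-2 ^ (j + N) - 2 ^ (m + N) : ℤ) : ℂ) * T * Complex.I) =
            -((2 : ℂ) ^ (j + N) * T * Complex.I) - (2 : ℂ) ^ (m + N) * T * Complex.I := by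
          push_cast; ring
        rw [this, Complex.exp_sub, Complex.exp_neg, hper, hper]; simp
    rw [h2, add_zero]
    split_ifs with hjm
    · subst hjm
      simp [mul_comm, div_eq_mul_inv]
    · rw [integral_cexp_int_mul, mul_zero]
      · intro h
        have h' : (2 : ℤ) ^ (j + N) = 2 ^ (m + N) := sub_eq_zero.1 h
        have := Int.pow_right_injective (le_refl 2) h'
        omega
      · have : (((2 ^ (j + N) - 2 ^ (m + N) : ℤ) : ℂ) * T * Complex.I) =
            (2 : ℂ) ^ (j + N) * T * Complex.I - (2 : ℂ) ^ (m + N) * T * Complex.I := by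
          push_cast; ring
        rw [this, Complex.exp_sub, hper, hper, div_one]
  have hsum : HasSum (fun j => ∫ θ in c..(c + T), F j θ)
      (∫ θ in c..(c + T), (gapFunction (Complex.exp (θ * Complex.I)) -
        gapPartial N (Complex.exp (θ * Complex.I))) *
          Complex.exp (-(2 ^ (m + N) * Complex.I * θ))) := by
    refine intervalIntegral.hasSum_integral_of_dominated_convergence
      (fun j _ => 2 / ((j + N).factorial : ℝ)) (fun j => ?_) (fun j => ?_) ?_ ?_ ?_
    · refine Continuous.aestronglyMeasurable ?_
      rw [show F j = _ from funext (hF' j)]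
      fun_prop
    · refine Filter.Eventually.of_forall fun θ _ => ?_
      rw [hF', norm_mul, norm_div, norm_one, Complex.norm_natCast, div_mul_eq_mul_div, one_mul]
      gcongr
      refine (norm_add_le _ _).trans (le_of_eq ?_)
      have : ∀ l : ℤ, ‖Complex.exp (l * Complex.I * θ)‖ = 1 := fun l => by
        rw [show (l * Complex.I * θ : ℂ) = ((l * θ : ℝ) : ℂ) * Complex.I by push_cast; ring]
        exact Complex.norm_exp_ofReal_mul_I _
      rw [this, this]; norm_num
    · refine Filter.Eventually.of_forall fun θ _ => ?_
      have := (summable_nat_add_iff N).2 (Real.summable_pow_div_factorial 1)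
      simpa [div_eq_mul_inv] using this.mul_left 2
    · exact intervalIntegrable_const
    · refine Filter.Eventually.of_forall fun θ _ => ?_
      exact (gapFunction_sub_gapPartial (Complex.norm_exp_ofReal_mul_I θ) N).mul_right _
  simp_rw [hint] at hsum
  exact hsum.unique (hasSum_ite_eq m _)

/-- Since `n! ≤ n ^ n ≤ exp (n ^ 2)` and `n ^ 2` is eventually below `2 ^ n * δ / 2`, the inequality
would bound `exp (2 ^ n * δ / 2)` by `C`. -/
theorem not_exp_two_pow_le_factorial {C δ : ℝ} (hδ : 0 < δ) (N : ℕ)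
    (h : ∀ m : ℕ, Real.exp (2 ^ (m + N) * δ) ≤ C * ((m + N).factorial : ℝ)) : False := by
  have h1 : ∀ᶠ n : ℕ in Filter.atTop, (n : ℝ) ^ 2 / 2 ^ n < δ / 2 :=
    (tendsto_pow_const_div_const_pow_of_one_lt 2 one_lt_two).eventually_lt_const (half_pos hδ)
  have h2 : ∀ᶠ n : ℕ in Filter.atTop, C < (2 : ℝ) ^ n * (δ / 2) :=
    ((tendsto_pow_atTop_atTop_of_one_lt one_lt_two).atTop_mul_const
      (half_pos hδ)).eventually_gt_atTop C
  obtain ⟨n, hn1, hn2, hn3⟩ := (h1.and (h2.and (Filter.eventually_ge_atTop N))).exists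
  have hn := h (n - N)
  rw [Nat.sub_add_cancel hn3] at hn
  have hC : 0 ≤ C := by
    by_contra hC
    have := Real.exp_pos ((2 : ℝ) ^ n * δ)
    nlinarith [(Nat.cast_pos (α := ℝ)).2 n.factorial_pos]
  have hfac : (n.factorial : ℝ) ≤ Real.exp (2 ^ n * (δ / 2)) := by
    have h3 : (n : ℝ) ≤ Real.exp n := by linarith [Real.add_one_le_exp (n : ℝ)]
    calc (n.factorial : ℝ) ≤ (n : ℝ) ^ n := by exact_mod_cast n.factorial_le_pow
      _ ≤ Real.exp n ^ n := by gcongr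
      _ = Real.exp ((n : ℝ) ^ 2) := by rw [← Real.exp_nat_mul, sq]
      _ ≤ _ := by
        refine Real.exp_le_exp.2 ?_
        rw [div_lt_iff₀ (by positivity)] at hn1
        linarith
  have h4 : Real.exp (2 ^ n * δ) = Real.exp (2 ^ n * (δ / 2)) * Real.exp (2 ^ n * (δ / 2)) := by
    rw [← Real.exp_add]; ring_nf
  have h5 : Real.exp (2 ^ n * (δ / 2)) ≤ C := by
    refine le_of_mul_le_mul_right ?_ (Real.exp_pos (2 ^ n * (δ / 2)))
    rw [← h4]
    exact hn.trans (mul_le_mul_of_nonneg_left hfac hC)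
  linarith [Real.add_one_le_exp ((2 : ℝ) ^ n * (δ / 2))]

/-! ### No one-sided extension of the gap function -/

/-- `gapFunction` has no extension to the exterior side of any arc of the unit circle. -/
theorem gapFunction_not_extends_outer {z₁ : ℂ} {ρ : ℝ} (hz₁ : ‖z₁‖ = 1) (hρ : 0 < ρ)
    (hρ' : ρ ≤ 1 / 4) {f : ℂ → ℂ}
    (hc : ContinuousOn f (Metric.ball z₁ ρ ∩ {z | 1 ≤ ‖z‖}))
    (hd : DifferentiableOn ℂ f (Metric.ball z₁ ρ ∩ {z | 1 < ‖z‖}))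
    (hf : ∀ z ∈ Metric.ball z₁ ρ, ‖z‖ = 1 → f z = gapFunction z) : False := by
  -- A full period of the tail must fit well inside the disk.
  obtain ⟨N, hN⟩ : ∃ N : ℕ, 2 * π / 2 ^ N < ρ / 256 := by
    have := (tendsto_pow_atTop_atTop_of_one_lt (one_lt_two : (1 : ℝ) < 2)).const_div_atTop (2 * π)
    exact (this.eventually_lt_const (by positivity)).exists
  set T : ℝ := 2 * π / 2 ^ N with hT
  have hTpos : 0 < T := by positivity
  set θ₁ : ℝ := Complex.arg z₁ with hθ₁
  have hzθ : Complex.exp (θ₁ * Complex.I) = z₁ := by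
    have := Complex.norm_mul_exp_arg_mul_I z₁
    rwa [hz₁, Complex.ofReal_one, one_mul] at this
  set δ : ℝ := ρ / 256 with hδ
  have hδpos : 0 < δ := by positivity
  set ζ : ℂ := Complex.exp (T * Complex.I) with hζ
  have hζN : ζ ^ 2 ^ N = 1 := by
    have h := cexp_two_pow_mul_period (N := N) (j := 0)
    rw [zero_add, ← hT] at h
    rw [hζ, ← Complex.exp_nat_mul]
    push_cast
    rwa [← mul_assoc]
  have hζ1 : ‖ζ‖ = 1 := Complex.norm_exp_ofReal_mul_I T
  have hζ2 : ‖ζ - 1‖ ≤ ρ / 128 := by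
    have h1 : ‖(T * Complex.I : ℂ)‖ = T := by simp [abs_of_pos hTpos]
    have := Complex.norm_exp_sub_one_le (x := T * Complex.I) (by rw [h1]; linarith)
    rw [h1] at this
    linarith
  have hrot : ∀ z ∈ Metric.closedBall z₁ (ρ / 4), ζ * z ∈ Metric.ball z₁ ρ := by
    intro z hz
    rw [Metric.mem_closedBall, dist_eq_norm] at hz
    rw [Metric.mem_ball, dist_eq_norm]
    have h1 : ζ * z - z₁ = ζ * (z - z₁) + (ζ - 1) * z₁ := by ring
    have h2 := norm_add_le (ζ * (z - z₁)) ((ζ - 1) * z₁)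
    rw [norm_mul, norm_mul, hζ1, hz₁] at h2
    rw [h1]
    linarith
  have hrotn : ∀ z, ‖ζ * z‖ = ‖z‖ := fun z => by rw [norm_mul, hζ1, one_mul]
  set g : ℂ → ℂ := fun z => f z - gapPartial N z with hg
  have hgc : ContinuousOn g (Metric.ball z₁ ρ ∩ {z | 1 ≤ ‖z‖}) :=
    hc.sub ((differentiableOn_gapPartial N).continuousOn.mono fun z hz (h0 : z = 0) => by
      have : (1 : ℝ) ≤ ‖z‖ := hz.2
      rw [h0, norm_zero] at this; linarith)
  have hgd : DifferentiableOn ℂ g (Metric.ball z₁ ρ ∩ {z | 1 < ‖z‖}) :=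
    hd.sub ((differentiableOn_gapPartial N).mono fun z hz (h0 : z = 0) => by
      have : (1 : ℝ) < ‖z‖ := hz.2
      rw [h0, norm_zero] at this; linarith)
  have hside : ∀ z : ℂ, 0 < (1 : ℝ) * (‖z‖ - 1) ↔ 1 < ‖z‖ := fun z => by simp
  have hside' : ∀ z : ℂ, 0 ≤ (1 : ℝ) * (‖z‖ - 1) ↔ 1 ≤ ‖z‖ := fun z => by simp
  -- The tail is invariant under rotation by `ζ` on the circle; uniqueness from boundary values
  -- carries this to the extension outside.
  have hinv : ∀ z ∈ Metric.closedBall z₁ (ρ / 64), 1 ≤ ‖z‖ → g (ζ * z) = g z := by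
    intro z hz hz1
    have hsub4 : Metric.closedBall z₁ (ρ / 4) ⊆ Metric.ball z₁ ρ :=
      Metric.closedBall_subset_ball (by linarith)
    refine sub_eq_zero.1 (eq_zero_of_eq_zero_on_arc (s := 1) (ρ := ρ / 4) (Or.inl rfl)
      (by linarith) (by linarith) hz₁ (f := fun z => g (ζ * z) - g z) ?_ ?_ ?_
      (by convert hz using 2; ring) ((hside' z).2 hz1))
    · simp only [hside]
      refine DifferentiableOn.sub (hgd.comp (by fun_prop) fun x hx => ?_) (hgd.mono fun x hx => ?_)
      · exact ⟨hrot x (Metric.ball_subset_closedBall hx.1), hx.2.trans_eq (hrotn x).symm⟩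
      · exact ⟨hsub4 (Metric.ball_subset_closedBall hx.1), hx.2⟩
    · simp only [hside']
      refine ContinuousOn.sub (hgc.comp (by fun_prop) fun x hx => ?_) (hgc.mono fun x hx => ?_)
      · exact ⟨hrot x hx.1, hx.2.trans_eq (hrotn x).symm⟩
      · exact ⟨hsub4 hx.1, hx.2⟩
    · intro x hx hx1
      simp only [hg]
      rw [hf _ (hrot x hx) ((hrotn x).trans hx1), hf x (hsub4 hx) hx1,
        gapFunction_sub_gapPartial_mul hx1 hζN, sub_self]
  have hE : ∀ w : ℂ, w.re ∈ Set.Icc θ₁ (θ₁ + T) → w.im ∈ Set.Icc (-δ) 0 →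
      Complex.exp (w * Complex.I) ∈ Metric.closedBall z₁ (ρ / 64) ∩ {z | 1 ≤ ‖z‖} := by
    intro w hw1 hw2
    constructor
    · have h1 : Complex.exp (w * Complex.I) - z₁ =
          z₁ * (Complex.exp ((w - θ₁) * Complex.I) - 1) := by
        rw [sub_mul, Complex.exp_sub, hzθ, mul_sub, mul_div_cancel₀, mul_one]
        rw [← hzθ]; exact Complex.exp_ne_zero _
      have h2 : ‖(w - θ₁) * Complex.I‖ ≤ T + δ := by
        rw [norm_mul, Complex.norm_I, mul_one]
        refine (Complex.norm_le_abs_re_add_abs_im _).trans (add_le_add ?_ ?_)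
        · rw [Complex.sub_re, Complex.ofReal_re, abs_le]
          constructor <;> linarith [hw1.1, hw1.2]
        · rw [Complex.sub_im, Complex.ofReal_im, abs_le]
          constructor <;> linarith [hw2.1, hw2.2]
      have h3 := Complex.norm_exp_sub_one_le (h2.trans (by linarith))
      rw [Metric.mem_closedBall, dist_eq_norm, h1, norm_mul, hz₁, one_mul]
      linarith
    · rw [Set.mem_ofPred_eq, Complex.norm_exp]
      refine Real.one_le_exp ?_
      simpa using hw2.2
  have hEsub : Metric.closedBall z₁ (ρ / 64) ∩ {z | 1 ≤ ‖z‖} ⊆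
      Metric.ball z₁ ρ ∩ {z | 1 ≤ ‖z‖} :=
    Set.inter_subset_inter_left _ (Metric.closedBall_subset_ball (by linarith))
  obtain ⟨C, hC⟩ := ((isCompact_closedBall z₁ (ρ / 64)).inter_right
    (isClosed_le continuous_const continuous_norm)).exists_bound_of_continuousOn (hgc.mono hEsub)
  refine not_exp_two_pow_le_factorial (C := C) hδpos N fun m => ?_
  set Φ : ℂ → ℂ := fun w => g (Complex.exp (w * Complex.I)) *
    Complex.exp (-(2 ^ (m + N) * Complex.I * w)) with hΦ
  -- Cauchy's theorem in the coordinate `w` with `z = exp (i w)`, where `Im w < 0` is the exterior.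
  -- The vertical sides cancel by periodicity, the top side is the Fourier coefficient, and on the
  -- bottom side the exponential factor has modulus `exp (-2 ^ (m + N) δ)`; `C` does not depend on
  -- `m`.
  have hrect := Complex.integral_boundary_rect_eq_zero_of_continuousOn_of_differentiableOn Φ
    ⟨θ₁, -δ⟩ ⟨θ₁ + T, 0⟩ ?_ ?_
  · have hvert : ∀ y ∈ Set.uIcc (-δ) 0, Φ ((θ₁ + T : ℝ) + y * Complex.I) =
        Φ (θ₁ + y * Complex.I) := by
      intro y hy
      rw [Set.uIcc_of_le (by linarith)] at hy
      have h1 : ((θ₁ + T : ℝ) + y * Complex.I) * Complex.I =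
          T * Complex.I + (θ₁ + y * Complex.I) * Complex.I := by push_cast; ring
      have h2 : (-(2 ^ (m + N) * Complex.I * ((θ₁ + T : ℝ) + y * Complex.I)) : ℂ) =
          -(2 ^ (m + N) * Complex.I * (θ₁ + y * Complex.I)) -
            2 ^ (m + N) * T * Complex.I := by push_cast; ring
      have h3 := hE (θ₁ + y * Complex.I) (by simp [hTpos.le]) (by simpa using hy)
      simp only [hΦ]
      rw [h1, h2, Complex.exp_add, hinv _ h3.1 h3.2, Complex.exp_sub, hT,
        cexp_two_pow_mul_period, div_one]
    have hvert' := intervalIntegral.integral_congr (μ := MeasureTheory.volume) hvert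
    simp only [hvert'] at hrect
    rw [add_sub_cancel_right, sub_eq_zero] at hrect
    have htop : ∫ x in θ₁..(θ₁ + T), Φ (x + ((0 : ℝ) : ℂ) * Complex.I) =
        T / ((m + N).factorial : ℂ) := by
      rw [hT, ← integral_gapFunction_sub_gapPartial θ₁ N m, ← hT]
      refine intervalIntegral.integral_congr fun x hx => ?_
      rw [Set.uIcc_of_le (by linarith)] at hx
      have h3 := hE x (by simpa using hx) (by simp [hδpos.le])
      simp only [hΦ, hg, Complex.ofReal_zero, zero_mul, add_zero]
      rw [hf _ (hEsub h3).1 (Complex.norm_exp_ofReal_mul_I x)]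
    have hbot : ‖∫ x in θ₁..(θ₁ + T), Φ (x + ((-δ : ℝ) : ℂ) * Complex.I)‖ ≤
        C * Real.exp (-(2 ^ (m + N) * δ)) * |θ₁ + T - θ₁| := by
      refine intervalIntegral.norm_integral_le_of_norm_le_const fun x hx => ?_
      rw [Set.uIoc_of_le (by linarith)] at hx
      have h3 := hE (x + ((-δ : ℝ) : ℂ) * Complex.I) (by simpa using ⟨hx.1.le, hx.2⟩)
        (by simp [hδpos.le])
      have h4 : (-(2 ^ (m + N) * Complex.I * (x + ((-δ : ℝ) : ℂ) * Complex.I)) : ℂ) =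
          ((-(2 ^ (m + N) * δ) : ℝ) : ℂ) + ((-(2 ^ (m + N) * x) : ℝ) : ℂ) * Complex.I := by
        push_cast
        linear_combination (2 ^ (m + N) * δ : ℂ) * Complex.I_sq
      rw [hΦ, norm_mul, h4, Complex.exp_add, norm_mul, Complex.norm_exp_ofReal_mul_I, mul_one,
        Complex.norm_exp_ofReal]
      gcongr
      exact hC _ h3
    rw [hrect, htop, add_sub_cancel_left, abs_of_pos hTpos, norm_div, Complex.norm_natCast,
      Complex.norm_real, Real.norm_of_nonneg hTpos.le, div_eq_mul_inv, mul_comm T] at hbot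
    have h5 := le_of_mul_le_mul_right hbot hTpos
    have hfp : (0 : ℝ) < (m + N).factorial := by exact_mod_cast (m + N).factorial_pos
    rw [Real.exp_neg, inv_eq_one_div, ← div_eq_mul_inv,
      div_le_div_iff₀ hfp (Real.exp_pos _), one_mul] at h5
    exact h5
  · simp only [Set.uIcc_of_le (show θ₁ ≤ θ₁ + T by linarith),
      Set.uIcc_of_le (show -δ ≤ 0 by linarith)]
    refine ContinuousOn.mul ((hgc.mono hEsub).comp (by fun_prop) fun w hw => ?_) (by fun_prop)
    exact hE w hw.1 hw.2
  · simp only [min_eq_left (show θ₁ ≤ θ₁ + T by linarith),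
      max_eq_right (show θ₁ ≤ θ₁ + T by linarith), min_eq_left (show -δ ≤ 0 by linarith),
      max_eq_right (show -δ ≤ 0 by linarith)]
    refine DifferentiableOn.mul (hgd.comp (by fun_prop) fun w hw => ?_) (by fun_prop)
    refine ⟨(hEsub (hE w (Set.Ioo_subset_Icc_self hw.1) (Set.Ioo_subset_Icc_self hw.2))).1, ?_⟩
    rw [Set.mem_ofPred_eq, Complex.norm_exp]
    refine Real.one_lt_exp_iff.2 ?_
    simpa using hw.2.2

/-- `gapFunction` has no extension to the interior side of any arc of the unit circle. -/
theorem gapFunction_not_extends_inner {z₁ : ℂ} {ρ : ℝ} (hz₁ : ‖z₁‖ = 1) (hρ : 0 < ρ)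
    (hρ' : ρ ≤ 1 / 4) {f : ℂ → ℂ}
    (hc : ContinuousOn f (Metric.ball z₁ ρ ∩ {z | ‖z‖ ≤ 1}))
    (hd : DifferentiableOn ℂ f (Metric.ball z₁ ρ ∩ {z | ‖z‖ < 1}))
    (hf : ∀ z ∈ Metric.ball z₁ ρ, ‖z‖ = 1 → f z = gapFunction z) : False := by
  have hz0 : z₁ ≠ 0 := by rintro rfl; simp at hz₁
  have hne : ∀ z : ℂ, 1 ≤ ‖z‖ → z ≠ 0 := by
    rintro z hz rfl
    rw [norm_zero] at hz; linarith
  have hball : ∀ z ∈ Metric.ball z₁⁻¹ ρ, 1 ≤ ‖z‖ → z⁻¹ ∈ Metric.ball z₁ ρ := by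
    intro z hz hz1
    rw [Metric.mem_ball, dist_eq_norm] at hz ⊢
    have h1 : z⁻¹ - z₁ = -((z - z₁⁻¹) * z₁ / z) := by
      have := hne z hz1
      field_simp
      ring
    rw [h1, norm_neg, norm_div, norm_mul, hz₁, mul_one]
    exact (div_le_self (norm_nonneg _) hz1).trans_lt hz
  refine gapFunction_not_extends_outer (z₁ := z₁⁻¹) (f := fun z => f z⁻¹)
    (by rw [norm_inv, hz₁, inv_one]) hρ hρ' ?_ ?_ ?_
  · refine hc.comp (continuousOn_inv₀.mono fun z hz => hne z hz.2) fun z hz => ⟨hball z hz.1 hz.2, ?_⟩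
    rw [Set.mem_ofPred_eq, norm_inv]
    exact inv_le_one_of_one_le₀ hz.2
  · refine hd.comp (differentiableOn_inv.mono fun z hz => hne z (le_of_lt hz.2)) fun z hz =>
      ⟨hball z hz.1 (le_of_lt hz.2), ?_⟩
    rw [Set.mem_ofPred_eq, norm_inv]
    exact inv_lt_one_of_one_lt₀ hz.2
  · intro z hz hz1
    rw [hf _ (hball z hz hz1.ge) (by rw [norm_inv, hz1, inv_one]), gapFunction_inv]

/-! ### The gap function in `C^k(I)` and the conclusion -/

namespace CompactArc

/-- The restriction of `gapFunction` to `I` as an element of `C^k(I)`. -/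
noncomputable def gapCk (I : CompactArc) (k : ℕ∞) : Ck I k :=
  ⟨fun w => gapFunction w, (contDiff_gapFunction k).contDiffOn.congr fun _ hθ =>
    I.pullback_of_mem (fun w => gapFunction w) hθ⟩

variable {I : CompactArc} {k : ℕ∞}

theorem gapCk_notMem_locExt_outer {z : ℂ} {ρ : ℝ} (hz : I.IsInner z ρ) :
    gapCk I k ∉ locExt I k {z | 0 < (1 : ℝ) * (‖z‖ - 1)} z ρ := by
  rintro ⟨f, hc, hd, hf⟩
  simp only [one_mul, sub_pos] at hc hd
  refine gapFunction_not_extends_outer hz.norm_eq hz.pos hz.le (hc.mono ?_) hd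
    fun w hw hw1 => hf ⟨w, hz.mem w (Metric.ball_subset_closedBall hw) hw1⟩
  rintro w ⟨hw, hw1⟩
  rcases lt_or_eq_of_le (show 1 ≤ ‖w‖ from hw1) with h | h
  · exact Or.inr ⟨hw, h⟩
  · exact Or.inl (hz.mem w (Metric.ball_subset_closedBall hw) h.symm)

theorem gapCk_notMem_locExt_inner {z : ℂ} {ρ : ℝ} (hz : I.IsInner z ρ) :
    gapCk I k ∉ locExt I k {z | 0 < (-1 : ℝ) * (‖z‖ - 1)} z ρ := by
  rintro ⟨f, hc, hd, hf⟩
  simp only [neg_mul, one_mul, neg_sub, sub_pos] at hc hd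
  refine gapFunction_not_extends_inner hz.norm_eq hz.pos hz.le (hc.mono ?_) hd
    fun w hw hw1 => hf ⟨w, hz.mem w (Metric.ball_subset_closedBall hw) hw1⟩
  rintro w ⟨hw, hw1⟩
  rcases lt_or_eq_of_le (show ‖w‖ ≤ 1 from hw1) with h | h
  · exact Or.inr ⟨hw, h⟩
  · exact Or.inl (hz.mem w (Metric.ball_subset_closedBall hw) h)

end CompactArc

theorem theorem4p7 (I : CompactArc) (k : ℕ∞) :
    (Dense (CompactArc.U₂ I k) ∧ IsGδ (CompactArc.U₂ I k)) ∧
    (Dense (CompactArc.U₃ I k) ∧ IsGδ (CompactArc.U₃ I k)) ∧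
    (Dense (CompactArc.U₄ I k) ∧ IsGδ (CompactArc.U₄ I k)) ∧
    (Dense (CompactArc.U₅ I k) ∧ IsGδ (CompactArc.U₅ I k)) := by
  have hout := CompactArc.isSideUnion_side (s := 1) (Or.inl rfl)
  have hin := CompactArc.isSideUnion_side (s := -1) (Or.inr rfl)
  have hd := CompactArc.dense_nonExt_inter hout hin
    (fun _ _ h => CompactArc.gapCk_notMem_locExt_outer (I := I) (k := k) h)
    (fun _ _ h => CompactArc.gapCk_notMem_locExt_inner h)
  rw [CompactArc.U₄_eq, CompactArc.U₅_eq, CompactArc.U₂_eq, CompactArc.U₃_eq]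
  refine ⟨⟨hd.mono Set.inter_subset_left, CompactArc.isGδ_nonExt hout⟩,
    ⟨hd.mono Set.inter_subset_right, CompactArc.isGδ_nonExt hin⟩,
    -- One dense set serves all four classes: it is `U₄`, and it lies in `U₂` and `U₃`; moreover
    -- `U₂` lies in `U₅`, since a two-sided extension restricts to the outer side.
    ⟨hd, (CompactArc.isGδ_nonExt hout).inter (CompactArc.isGδ_nonExt hin)⟩,
    ⟨hd.mono (Set.inter_subset_left.trans (CompactArc.nonExt_mono (Set.subset_univ _))),
      CompactArc.isGδ_nonExt CompactArc.isSideUnion_univ⟩⟩
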